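/- **Data.** Client-visible pointers are partitioned into control pointers ($\mathsf{cptr}$) and data pointers ($\mathsf{dptr}$). $\mathsf{Val}$ is the set of values: the unit value $tt$, the client-visible pointers, and arbitrary other values; it contains neither RDCSS descriptors nor pointers storing descriptors. An RDCSS descriptor is a record $desc=(pt_1:\mathsf{cptr},\ pt_2:\mathsf{dptr},\ exp_1,exp_2,new_2:\mathsf{Val})$. Descriptors are stored at separate data pointers, not visible to clients, and $is\_rdesc(w)$ is true iff $w$ is such a pointer. Control pointers hold elements of $\mathsf{Val}$; client data pointers hold elements of $\mathsf{Val}$ or pointers to descriptors. **Implementation.** The shared-memory primitives are dereference $!p$, assignment $p:=v$, $CAS(p,e,n)$ (returns the old contents) and $Alloc$ (returns a previously unallocated pointer of the requested sort; nothing is deallocated). They are linearizable: each takes effect at one moment between its call and its return. The exported procedures are: - $rdcss(desc)$: $d\gets Alloc(desc)$, a fresh pointer with $is\_rdesc(d)$; return $loop(d,desc)$. - $rread(pt:\mathsf{dptr})$: $old\gets{!pt}$; if $is\_rdesc(old)$ then $complete(old)$ and return $rread(pt)$; else return $old$. - $rCAS(pt:\mathsf{dptr},exp,new)$: $old\gets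 CAS(pt,exp,new)$; if $is\_rdesc(old)$ then $complete(old)$ and return $rCAS(pt,exp,new)$; else return $old$. - $rwrite(pt:\mathsf{dptr},v)$: $old\gets{!pt}$; if $is\_rdesc(old)$ then $complete(old)$ and $rwrite(pt,v)$; else $x\gets CAS(pt,old,v)$ and, if $x\ne old$, $rwrite(pt,v)$; it outputs $tt$. - On control pointers: $rread\text{-}c(pt)$ returns $!pt$; $rCAS\text{-}c(pt,exp,new)$ returns $CAS(pt,exp,new)$; $rwrite\text{-}c(pt,v)$ performs $pt:=v$ and outputs $tt$. - $ralloc(v,k)$, $k\in\{\mathsf{cptr},\mathsf{dptr}\}$: return $Alloc(v)$, a fresh client-visible pointer of kind $k$. The internal procedures are: - $loop(d,desc)$: $old\gets CAS(desc.pt_2,desc.exp_2,d)$; if $is\_rdesc(old)$ then $complete(old)$ and return $loop(d,desc)$; else, if $old=desc.exp_2$ then $complete(d)$; return $old$. - $complete(d)$: $desc\gets{!d}$; $x\gets{!desc.pt_1}$; if $x=desc.exp_1$ then $CAS(desc.pt_2,d,desc.new_2)$ else $CAS(desc.pt_2,d,desc.exp_2)$. Arbitrarily many threads run concurrently. Initially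 nothing is allocated. At any time an idle thread may invoke any exported procedure with arbitrary inputs, provided that the pointers on which the procedure is called ($pt$, resp. $desc.pt_1$ and $desc.pt_2$) have been allocated by $ralloc$. **Sequential semantics.** States are partial maps $H$ from client-visible pointers to $\mathsf{Val}$, and $\langle o\rangle$ is the output. - $rdcss(d)\langle v\rangle$: $H\to H$ if $H(d.pt_2)=v\neq d.exp_2$. $rdcss(d)\langle d.exp_2\rangle$: if $H(d.pt_2)=d.exp_2$, then $H\to H$ when $H(d.pt_1)\ne d.exp_1$, and $H\to H[d.pt_2\mapsto d.new_2]$ when $H(d.pt_1)=d.exp_1$ (with $d.pt_1\in dom(H)$ in both cases). - $ralloc(v,k)\langle p\rangle$: $H\to H[p\mapsto v]$ if $p\notin dom(H)$ and $p$ is of kind $k$. - $rCAS(p,e,n)\langle v\rangle$: $H\to H$ if $H(p)=v\ne e$. $rCAS(p,e,n)\langle e\rangle$: $H\to H[p\mapsto n]$ if $H(p)=e$. - $rwrite(p,v)\langle tt\rangle$: $H\to H[p\mapsto v]$ if $p\in dom(H)$. - $rread(p)\langle v\rangle$: $H\to H$ if $H(p)=v$. - $rCAS\text{-}c$, $rwrite\text{-}c$,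 $rread\text{-}c$: the same as $rCAS$, $rwrite$, $rread$, for control pointers. **Theorem.** The RDCSS implementation is linearizable. That is, let $\mathsf{Ev}$ be the set of events (invocations of exported procedures) of an arbitrary finite execution history of the implementation, and let $T\subseteq\mathsf{Ev}$ be the set of terminated events. Then there are a binary relation $\prec$ on $\mathsf{Ev}$ and a linear order $\le$ on $\mathsf{Ev}^c=\{e\mid\exists t\in T.\ e\prec^* t\}$ such that: 1. if $x,y\in\mathsf{Ev}^c$ and $x$ ended before $y$ started, then $x\le y$; 2. if $x,y\in\mathsf{Ev}^c$ and $x\prec y$, then $x\le y$; 3. $\le$ is sequentially sound: the sequential semantics has a path starting from the empty heap, with $|\mathsf{Ev}^c|$ steps, whose $i$-th step has the procedure name and the input of the $i$-th event of $\mathsf{Ev}^c$ under $\le$ and, if that event has terminated, also its output. -/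

import Mathlib

/-! ### Execution histories, events and linearizability -/

namespace Concurrency

/-- The actions of an execution: thread `t` invokes the exported procedure call `op`, some thread
performs an internal step, thread `t` returns from its pending invocation with output `out`. -/
inductive Label (Tid Op Out : Type*)
  | inv (t : Tid) (op : Op)
  | tau
  | res (t : Tid) (out : Out)

section Histories

variable {Tid Op Out Heap : Type*}

/-- The events `Ev` of the history `h`: the invocations of exported procedures occurring in it.
Time is the position in the history; `time` is the start time of the event. -/
structure Event (h : List (Label Tid Op Out)) where
  time : ℕ
  tid : Tid
  op : Op
  isInv : h[time]? = some (Label.inv tid op)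

variable {h : List (Label Tid Op Out)}

/-- The event `x` has end time `j` and output `v`: the first response of the invoking thread after
the start of `x` is at time `j`, with output `v`. -/
def Event.Ends (x : Event h) (j : ℕ) (v : Out) : Prop :=
  x.time < j ∧ h[j]? = some (Label.res x.tid v) ∧
    ∀ (k : ℕ) (w : Out), x.time < k → k < j → h[k]? ≠ some (Label.res x.tid w)

/-- The event has an end time. -/
def Event.Terminated (x : Event h) : Prop :=
  ∃ (j : ℕ) (v : Out), x.Ends j v

/-- Returns-before: `x` ends before `y` starts. -/
def Event.Precedes (x y : Event h) : Prop :=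
  ∃ (j : ℕ) (v : Out), x.Ends j v ∧ j < y.time

/-- The closure of the set of terminated events under `vis`. -/
def closedEvents (vis : Event h → Event h → Prop) : Set (Event h) :=
  {x | ∃ y : Event h, y.Terminated ∧ Relation.ReflTransGen vis x y}

/-- Paths in the operational semantics `sem`, where `sem H op out H'` is the step from `H` to `H'`
labelled by the procedure call `op` with output `out`. -/
inductive Path (sem : Heap → Op → Out → Heap → Prop) : Heap → List (Op × Out) → Heap → Prop
  | nil (H : Heap) : Path sem H [] H
  | cons {H H' H'' : Heap} {op : Op} {out : Out} {P : List (Op × Out)} :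
      sem H op out H' → Path sem H' P H'' → Path sem H ((op, out) :: P) H''

/-- Sequential soundness of the order `le` on the set of events `S`: `l` lists all of `S`
in the order `le`, and there is a path from `H₀` with one step for each event of `l`, whose `i`-th
step has the procedure name and input of the `i`-th event and, if that event has terminated,
its output. -/
def SequentiallySound (sem : Heap → Op → Out → Heap → Prop) (H₀ : Heap)
    (S : Set (Event h)) (le : S → S → Prop) : Prop :=
  ∃ (l : List S) (P : List (Op × Out)) (H : Heap),
    (∀ x : S, x ∈ l) ∧ l.Nodup ∧ l.Pairwise le ∧
    Path sem H₀ P H ∧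
    List.Forall₂ (fun (x : S) (s : Op × Out) =>
      s.1 = x.1.op ∧ ∀ (j : ℕ) (v : Out), x.1.Ends j v → s.2 = v) l P

/-- The history `h` is linearizable with respect to the sequential semantics `sem` with initial
heap `H₀`: there are a general visibility relation `vis` on the events and a linear order `le` on
the closure of the terminated events under `vis`, which contains the restrictions of returns-before
and of `vis` and is sequentially sound. -/
def Linearizable (sem : Heap → Op → Out → Heap → Prop) (H₀ : Heap)
    (h : List (Label Tid Op Out)) : Prop :=
  ∃ (vis : Event h → Event h → Prop) (le : closedEvents vis → closedEvents vis → Prop),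
    IsLinearOrder (closedEvents vis) le ∧
    (∀ x y : closedEvents vis, x.1.Precedes y.1 → le x y) ∧
    (∀ x y : closedEvents vis, vis x.1 y.1 → le x y) ∧
    SequentiallySound sem H₀ (closedEvents vis) le

end Histories

end Concurrency

/-! ### The RDCSS data structure

Type parameters: `B` the values other than pointers and the unit value, `C` the control pointers,
`D` the data pointers exposed to clients, `R` the data pointers that store RDCSS descriptors
(those for which `is_rdesc` returns true), `Tid` the threads. -/

namespace RDCSS

open Concurrency

inductive PtrKind
  | cptr
  | dptr

/-- Pointers exposed to clients. -/
inductive Ptr (C D : Type*)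
  | cptr (c : C)
  | dptr (d : D)

def Ptr.kind {C D : Type*} : Ptr C D → PtrKind
  | .cptr _ => .cptr
  | .dptr _ => .dptr

/-- The set `Val` of input and output values. It contains the client pointers, but neither
descriptors nor pointers storing descriptors. -/
inductive Val (B C D : Type*)
  | tt
  | base (b : B)
  | ptr (p : Ptr C D)

/-- RDCSS descriptors. -/
structure Desc (B C D : Type*) where
  pt1 : C
  pt2 : D
  exp1 : Val B C D
  exp2 : Val B C D
  new2 : Val B C D

/-- The contents of a client data pointer: a value, or a pointer storing a descriptor. The predicate
`is_rdesc` holds exactly for the second kind. -/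
inductive Word (B C D R : Type*)
  | val (v : Val B C D)
  | rdesc (r : R)

/-- Calls of exported procedures. -/
inductive Op (B C D : Type*)
  | rdcss (desc : Desc B C D)
  | rread (pt : D)
  | rCAS (pt : D) (exp new : Val B C D)
  | rwrite (pt : D) (v : Val B C D)
  | rreadC (pt : C)
  | rCASC (pt : C) (exp new : Val B C D)
  | rwriteC (pt : C) (v : Val B C D)
  | ralloc (v : Val B C D) (k : PtrKind)

/-! #### Sequential operational semantics -/

/-- Abstract heaps: finite or infinite partial maps from client pointers to values. -/
abbrev Heap (B C D : Type*) := Ptr C D → Option (Val B C D)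

def emptyHeap (B C D : Type*) : Heap B C D := fun _ => none

section Semantics

variable {B C D : Type*}

open Classical in
noncomputable def Heap.set (H : Heap B C D) (p : Ptr C D) (v : Val B C D) : Heap B C D :=
  Function.update H p (some v)

/-- `OpStep H op out H'`: executing `op` atomically in `H` outputs `out` and gives `H'`. -/
inductive OpStep : Heap B C D → Op B C D → Val B C D → Heap B C D → Prop
  | rdcss_ne (H : Heap B C D) (d : Desc B C D) (v : Val B C D) :
      H (.dptr d.pt2) = some v → v ≠ d.exp2 →
      OpStep H (.rdcss d) v H
  | rdcss_undo (H : Heap B C D) (d : Desc B C D) (u : Val B C D) :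
      H (.dptr d.pt2) = some d.exp2 → H (.cptr d.pt1) = some u → u ≠ d.exp1 →
      OpStep H (.rdcss d) d.exp2 H
  | rdcss_set (H : Heap B C D) (d : Desc B C D) :
      H (.dptr d.pt2) = some d.exp2 → H (.cptr d.pt1) = some d.exp1 →
      OpStep H (.rdcss d) d.exp2 (H.set (.dptr d.pt2) d.new2)
  | ralloc (H : Heap B C D) (v : Val B C D) (k : PtrKind) (p : Ptr C D) :
      p.kind = k → H p = none →
      OpStep H (.ralloc v k) (.ptr p) (H.set p v)
  | rCAS_ne (H : Heap B C D) (p : D) (e n v : Val B C D) :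
      H (.dptr p) = some v → v ≠ e →
      OpStep H (.rCAS p e n) v H
  | rCAS_eq (H : Heap B C D) (p : D) (e n : Val B C D) :
      H (.dptr p) = some e →
      OpStep H (.rCAS p e n) e (H.set (.dptr p) n)
  | rwrite (H : Heap B C D) (p : D) (v : Val B C D) :
      H (.dptr p) ≠ none →
      OpStep H (.rwrite p v) .tt (H.set (.dptr p) v)
  | rread (H : Heap B C D) (p : D) (v : Val B C D) :
      H (.dptr p) = some v →
      OpStep H (.rread p) v H
  | rCASC_ne (H : Heap B C D) (p : C) (e n v : Val B C D) :
      H (.cptr p) = some v → v ≠ e →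
      OpStep H (.rCASC p e n) v H
  | rCASC_eq (H : Heap B C D) (p : C) (e n : Val B C D) :
      H (.cptr p) = some e →
      OpStep H (.rCASC p e n) e (H.set (.cptr p) n)
  | rwriteC (H : Heap B C D) (p : C) (v : Val B C D) :
      H (.cptr p) ≠ none →
      OpStep H (.rwriteC p v) .tt (H.set (.cptr p) v)
  | rreadC (H : Heap B C D) (p : C) (v : Val B C D) :
      H (.cptr p) = some v →
      OpStep H (.rreadC p) v H

end Semantics

/-! #### The implementation -/

/-- The shared memory; `none` at the pointers that have not been allocated. -/
structure Mem (B C D R : Type*) where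
  ctrl : C → Option (Val B C D)
  data : D → Option (Word B C D R)
  desc : R → Option (Desc B C D)

/-- Program points with the values of the local variables. Except for `ret`, each is a primitive call
(dereference, `CAS`, assignment or `Alloc`) in the code of a procedure. The argument `k` of the points
of procedure `complete` is where execution continues after `complete` returns. -/
inductive PC (B C D R : Type*)
  /- rdcss(desc):  d := Alloc(desc) as dptr;  return rdcssLoop(d, desc) -/
  | rdcssAlloc (desc : Desc B C D)
  /- rdcssLoop(d, desc):
       old := CAS(desc.pt2, desc.exp2, d)
       if is_rdesc(old) then { complete(old); return rdcssLoop(d, desc) }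
       else { if old = desc.exp2 then complete(d);  return old } -/
  | loopCAS (d : R) (desc : Desc B C D)
  /- complete(d):
       desc := !d
       x := !desc.pt1
       if x = desc.exp1 then CAS(desc.pt2, d, desc.new2) else CAS(desc.pt2, d, desc.exp2) -/
  | completeReadDesc (d : R) (k : PC B C D R)
  | completeReadPt1 (d : R) (desc : Desc B C D) (k : PC B C D R)
  | completeCASNew (d : R) (desc : Desc B C D) (k : PC B C D R)
  | completeCASExp (d : R) (desc : Desc B C D) (k : PC B C D R)
  /- rread(pt):
       old := !pt
       if is_rdesc(old) then { complete(old); return rread(pt) } else return old -/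
  | rreadRead (pt : D)
  /- rCAS(pt, exp, new):
       old := CAS(pt, exp, new)
       if is_rdesc(old) then { complete(old); return rCAS(pt, exp, new) } else return old -/
  | rCASCAS (pt : D) (exp new : Val B C D)
  /- rwrite(pt, v):
       old := !pt
       if is_rdesc(old) then { complete(old); rwrite(pt, v) }
       else { x := CAS(pt, old, v);  if x /= old then rwrite(pt, v) } -/
  | rwriteRead (pt : D) (v : Val B C D)
  | rwriteCAS (pt : D) (old v : Val B C D)
  /- rread-c(pt):  return !pt -/
  | rreadC (pt : C)
  /- rCAS-c(pt, exp, new):  return CAS(pt, exp, new) -/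
  | rCASC (pt : C) (exp new : Val B C D)
  /- rwrite-c(pt, v):  pt := v -/
  | rwriteC (pt : C) (v : Val B C D)
  /- ralloc(v, k):  if k = cptr then return Alloc(v) as cptr else return Alloc(v) as dptr -/
  | rallocCtrl (v : Val B C D)
  | rallocData (v : Val B C D)
  /- The procedure is about to return `out`. -/
  | ret (out : Val B C D)

section Implementation

variable {Tid B C D R : Type*}

open Classical in
noncomputable def Mem.setCtrl (m : Mem B C D R) (p : C) (v : Val B C D) : Mem B C D R :=
  { m with ctrl := Function.update m.ctrl p (some v) }

open Classical in
noncomputable def Mem.setData (m : Mem B C D R) (p : D) (w : Word B C D R) : Mem B C D R :=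
  { m with data := Function.update m.data p (some w) }

open Classical in
noncomputable def Mem.setDesc (m : Mem B C D R) (r : R) (desc : Desc B C D) : Mem B C D R :=
  { m with desc := Function.update m.desc r (some desc) }

open Classical in
/-- `CAS(p, e, n)` on a control pointer, returning the old contents `old`. -/
def Mem.CASCtrl (m : Mem B C D R) (p : C) (e n old : Val B C D) (m' : Mem B C D R) : Prop :=
  m.ctrl p = some old ∧ m' = if old = e then m.setCtrl p n else m

open Classical in
/-- `CAS(p, e, n)` on a data pointer, returning the old contents `old`. -/
def Mem.CASData (m : Mem B C D R) (p : D) (e n old : Word B C D R) (m' : Mem B C D R) : Prop :=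
  m.data p = some old ∧ m' = if old = e then m.setData p n else m

/-- Where the invocation of an exported procedure starts. -/
def Op.entry (R : Type*) : Op B C D → PC B C D R
  | .rdcss desc => .rdcssAlloc desc
  | .rread pt => .rreadRead pt
  | .rCAS pt e n => .rCASCAS pt e n
  | .rwrite pt v => .rwriteRead pt v
  | .rreadC pt => .rreadC pt
  | .rCASC pt e n => .rCASC pt e n
  | .rwriteC pt v => .rwriteC pt v
  | .ralloc v .cptr => .rallocCtrl v
  | .ralloc v .dptr => .rallocData v

open Classical in
/-- The code of `rdcssLoop` after its `CAS` returned. -/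
noncomputable def afterLoopCAS (d : R) (desc : Desc B C D) : Word B C D R → PC B C D R
  | .rdesc r => .completeReadDesc r (.loopCAS d desc)
  | .val old => if old = desc.exp2 then .completeReadDesc d (.ret old) else .ret old

open Classical in
/-- The code of `complete` after `desc.pt1` was read. -/
noncomputable def afterReadPt1 (d : R) (desc : Desc B C D) (k : PC B C D R) (x : Val B C D) :
    PC B C D R :=
  if x = desc.exp1 then .completeCASNew d desc k else .completeCASExp d desc k

/-- The code of `rread` after its dereference returned. -/
def afterRreadRead (pt : D) : Word B C D R → PC B C D R
  | .rdesc r => .completeReadDesc r (.rreadRead pt)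
  | .val old => .ret old

/-- The code of `rCAS` after its `CAS` returned. -/
def afterRCASCAS (pt : D) (e n : Val B C D) : Word B C D R → PC B C D R
  | .rdesc r => .completeReadDesc r (.rCASCAS pt e n)
  | .val old => .ret old

/-- The code of `rwrite` after its dereference returned. -/
def afterRwriteRead (pt : D) (v : Val B C D) : Word B C D R → PC B C D R
  | .rdesc r => .completeReadDesc r (.rwriteRead pt v)
  | .val old => .rwriteCAS pt old v

open Classical in
/-- The code of `rwrite` after its `CAS` returned. -/
noncomputable def afterRwriteCAS (pt : D) (old v : Val B C D) (x : Word B C D R) : PC B C D R :=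
  if x = .val old then .ret .tt else .rwriteRead pt v

/-- `Exec pc m pc' m'`: the primitive called at `pc` takes effect, changing the memory from `m` to
`m'`; once it has returned, the thread continues at `pc'`. Allocation returns an arbitrary pointer of
the required kind that has not been allocated before; pointers are never deallocated. -/
inductive Exec : PC B C D R → Mem B C D R → PC B C D R → Mem B C D R → Prop
  | rdcssAlloc {m : Mem B C D R} {desc : Desc B C D} {d : R} :
      m.desc d = none →
      Exec (.rdcssAlloc desc) m (.loopCAS d desc) (m.setDesc d desc)
  | loopCAS {m m' : Mem B C D R} {d : R} {desc : Desc B C D} {old : Word B C D R} :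
      m.CASData desc.pt2 (.val desc.exp2) (.rdesc d) old m' →
      Exec (.loopCAS d desc) m (afterLoopCAS d desc old) m'
  | completeReadDesc {m : Mem B C D R} {d : R} {k : PC B C D R} {desc : Desc B C D} :
      m.desc d = some desc →
      Exec (.completeReadDesc d k) m (.completeReadPt1 d desc k) m
  | completeReadPt1 {m : Mem B C D R} {d : R} {desc : Desc B C D} {k : PC B C D R}
      {x : Val B C D} :
      m.ctrl desc.pt1 = some x →
      Exec (.completeReadPt1 d desc k) m (afterReadPt1 d desc k x) m
  | completeCASNew {m m' : Mem B C D R} {d : R} {desc : Desc B C D} {k : PC B C D R}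
      {old : Word B C D R} :
      m.CASData desc.pt2 (.rdesc d) (.val desc.new2) old m' →
      Exec (.completeCASNew d desc k) m k m'
  | completeCASExp {m m' : Mem B C D R} {d : R} {desc : Desc B C D} {k : PC B C D R}
      {old : Word B C D R} :
      m.CASData desc.pt2 (.rdesc d) (.val desc.exp2) old m' →
      Exec (.completeCASExp d desc k) m k m'
  | rreadRead {m : Mem B C D R} {pt : D} {old : Word B C D R} :
      m.data pt = some old →
      Exec (.rreadRead pt) m (afterRreadRead pt old) m
  | rCASCAS {m m' : Mem B C D R} {pt : D} {e n : Val B C D} {old : Word B C D R} :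
      m.CASData pt (.val e) (.val n) old m' →
      Exec (.rCASCAS pt e n) m (afterRCASCAS pt e n old) m'
  | rwriteRead {m : Mem B C D R} {pt : D} {v : Val B C D} {old : Word B C D R} :
      m.data pt = some old →
      Exec (.rwriteRead pt v) m (afterRwriteRead pt v old) m
  | rwriteCAS {m m' : Mem B C D R} {pt : D} {old v : Val B C D} {x : Word B C D R} :
      m.CASData pt (.val old) (.val v) x m' →
      Exec (.rwriteCAS pt old v) m (afterRwriteCAS pt old v x) m'
  | rreadC {m : Mem B C D R} {pt : C} {v : Val B C D} :
      m.ctrl pt = some v →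
      Exec (.rreadC pt) m (.ret v) m
  | rCASC {m m' : Mem B C D R} {pt : C} {e n old : Val B C D} :
      m.CASCtrl pt e n old m' →
      Exec (.rCASC pt e n) m (.ret old) m'
  | rwriteC {m : Mem B C D R} {pt : C} {v : Val B C D} :
      m.ctrl pt ≠ none →
      Exec (.rwriteC pt v) m (.ret .tt) (m.setCtrl pt v)
  | rallocCtrl {m : Mem B C D R} {v : Val B C D} {p : C} :
      m.ctrl p = none →
      Exec (.rallocCtrl v) m (.ret (.ptr (.cptr p))) (m.setCtrl p v)
  | rallocData {m : Mem B C D R} {v : Val B C D} {p : D} :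
      m.data p = none →
      Exec (.rallocData v) m (.ret (.ptr (.dptr p))) (m.setData p (.val v))

/-- The client pointer `p` has been allocated (which only `ralloc` does). -/
def Mem.Allocated (m : Mem B C D R) : Ptr C D → Prop
  | .cptr c => m.ctrl c ≠ none
  | .dptr d => m.data d ≠ none

/-- The pointers on which an exported procedure is called. -/
def Op.inputPtrs : Op B C D → List (Ptr C D)
  | .rdcss desc => [.cptr desc.pt1, .dptr desc.pt2]
  | .rread pt => [.dptr pt]
  | .rCAS pt _ _ => [.dptr pt]
  | .rwrite pt _ => [.dptr pt]
  | .rreadC pt => [.cptr pt]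
  | .rCASC pt _ _ => [.cptr pt]
  | .rwriteC pt _ => [.cptr pt]
  | .ralloc _ _ => []

/-- The state of a thread: not running a procedure; the primitive at `pc` has been called and has
not taken effect yet; the last primitive has taken effect but has not returned yet, and then
execution continues at `pc`. So primitives are not instantaneous: each takes effect at some moment
between its call and its return. -/
inductive Thread (B C D R : Type*)
  | idle
  | calling (pc : PC B C D R)
  | returning (pc : PC B C D R)

structure State (Tid B C D R : Type*) where
  mem : Mem B C D R
  thread : Tid → Thread B C D R

/-- Nothing is allocated and all threads are idle. -/
def State.init (Tid B C D R : Type*) : State Tid B C D R where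
  mem := ⟨fun _ => none, fun _ => none, fun _ => none⟩
  thread := fun _ => .idle

open Classical in
noncomputable def State.setThread (s : State Tid B C D R) (t : Tid) (l : Thread B C D R) :
    State Tid B C D R :=
  { s with thread := Function.update s.thread t l }

/-- The steps of the concurrent system. An idle thread may invoke any exported procedure on
pointers that have been allocated. -/
inductive Step :
    State Tid B C D R → Label Tid (Op B C D) (Val B C D) → State Tid B C D R → Prop
  | invoke {s : State Tid B C D R} {t : Tid} {op : Op B C D} :
      s.thread t = .idle → (∀ p ∈ op.inputPtrs, s.mem.Allocated p) →
      Step s (.inv t op) (s.setThread t (.calling (op.entry R)))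
  | effect {s : State Tid B C D R} {t : Tid} {pc pc' : PC B C D R} {m' : Mem B C D R} :
      s.thread t = .calling pc → Exec pc s.mem pc' m' →
      Step s .tau { s.setThread t (.returning pc') with mem := m' }
  | primReturn {s : State Tid B C D R} {t : Tid} {pc : PC B C D R} :
      s.thread t = .returning pc →
      Step s .tau (s.setThread t (.calling pc))
  | respond {s : State Tid B C D R} {t : Tid} {out : Val B C D} :
      s.thread t = .calling (.ret out) →
      Step s (.res t out) (s.setThread t .idle)

/-- `Run h s`: the implementation has an execution with history `h` ending in state `s`. -/
inductive Run : List (Label Tid (Op B C D) (Val B C D)) → State Tid B C D R → Prop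
  | nil : Run [] (State.init Tid B C D R)
  | snoc {h : List (Label Tid (Op B C D) (Val B C D))} {s s' : State Tid B C D R}
      {l : Label Tid (Op B C D) (Val B C D)} :
      Run h s → Step s l s' → Run (h ++ [l]) s'

end Implementation

end RDCSS

/-!
Every event is linearized at one of the primitives executed during it, and the events are ordered by
the positions of these primitives in the history. A log (`Ghost.log`) records which event is
linearized at which position; `Concurrency.Linearizable.of_log` derives linearizability from it, with
the order of execution as the visibility relation.

All procedures except a successful `rdcss` are linearized by their last primitive
(`Core.linearize`). A successful `rdcss` first installs its descriptor `r` in its data pointer. Any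
number of threads then try to complete it: each reads the control pointer and then tries to replace
`r` according to what it read, and only the first such `CAS` succeeds. The linearization point is the
read performed by the thread whose `CAS` succeeds, which is not known at the time of the read.
Therefore each of these reads keeps its position of the log empty (`Reserved`), and the event is
inserted there when `r` is removed (`Core.resolve`). This insertion into the past is sound because a
data pointer that stores a descriptor blocks all the procedures that access it: as long as `r` is
installed, no event touching the pointer is linearized (`Core.data_rdesc`), its abstract value is
`exp2`, and the executions of the other events do not depend on it (`OpStep.set_dptr`).

`Inv` is the resulting invariant of executions: `Core` relates memory and log, and `PointOK` says
what a thread knows at each program point. The latter is stable under the actions of the other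
threads (`PointOK.mono`), and each primitive preserves the invariants of its own thread
(`Exec.advances`).
-/

/-! ### Linearizations recorded in a log -/

namespace Concurrency

variable {Tid Op Out Heap : Type*} {h : List (Label Tid Op Out)}

theorem Path.snoc {sem : Heap → Op → Out → Heap → Prop} {H H' H'' : Heap} {P : List (Op × Out)}
    {op : Op} {out : Out} (hP : Path sem H P H') (hs : sem H' op out H'') :
    Path sem H (P ++ [(op, out)]) H'' := by
  induction hP with
  | nil H => exact .cons hs (.nil _)
  | cons h₁ _ ih => exact .cons h₁ (ih hs)

theorem Event.ext_time {x y : Event h} (hxy : x.time = y.time) : x = y := by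
  obtain ⟨e, t, op, hx⟩ := x
  obtain ⟨e', t', op', hy⟩ := y
  obtain rfl : e = e' := hxy
  have := hx.symm.trans hy
  simp only [Option.some.injEq, Label.inv.injEq] at this
  obtain ⟨rfl, rfl⟩ := this
  rfl

theorem Event.Ends.unique {x : Event h} {j j' : ℕ} {v v' : Out} (hj : x.Ends j v)
    (hj' : x.Ends j' v') : j = j' ∧ v = v' := by
  have hjj : j = j' := by
    rcases lt_trichotomy j j' with hlt | heq | hlt
    · exact absurd hj.2.1 (hj'.2.2 j v hj.1 hlt)
    · exact heq
    · exact absurd hj'.2.1 (hj.2.2 j' v' hj'.1 hlt)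
  subst hjj
  have := hj.2.1.symm.trans hj'.2.1
  simp only [Option.some.injEq, Label.res.injEq, true_and] at this
  exact ⟨rfl, this⟩

/-- A log assigns to some positions of the history an event (identified by its start time) that is
executed there, with its procedure call and its output. A log that replays as a path, executes each
event at most once and after its start, and executes each terminated event before its end and with
the right output, witnesses linearizability: visibility is the order of execution, so that the
closure of the terminated events is an initial segment of the log. -/
theorem Linearizable.of_log {sem : Heap → Op → Out → Heap → Prop} {H₀ : Heap}
    (log : ℕ → Option (ℕ × Op × Out)) (heap : ℕ → Heap) (heap_zero : heap 0 = H₀)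
    (heap_none : ∀ k, log k = none → heap (k + 1) = heap k)
    (heap_some : ∀ k e op out, log k = some (e, op, out) → sem (heap k) op out (heap (k + 1)))
    (log_inv : ∀ k e op out, log k = some (e, op, out) → ∃ t, h[e]? = some (.inv t op))
    (log_inj : ∀ k k' e op op' out out', log k = some (e, op, out) →
      log k' = some (e, op', out') → k = k')
    (log_lt : ∀ k e op out, log k = some (e, op, out) → e < k ∧ k < h.length)
    (log_ends : ∀ (x : Event h) j v, x.Ends j v → ∃ k op, log k = some (x.time, op, v) ∧ k < j) :
    Linearizable sem H₀ h := by
  classical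
  let Lin (x : Event h) (k : ℕ) : Prop := ∃ op out, log k = some (x.time, op, out)
  have lin_fun {x : Event h} {k k' : ℕ} : Lin x k → Lin x k' → k = k' :=
    fun ⟨_, _, h₁⟩ ⟨_, _, h₂⟩ => log_inj _ _ _ _ _ _ _ h₁ h₂
  have lin_inj {x y : Event h} {k : ℕ} : Lin x k → Lin y k → x = y := by
    rintro ⟨_, _, h₁⟩ ⟨_, _, h₂⟩
    have := h₁.symm.trans h₂
    simp only [Option.some.injEq, Prod.mk.injEq] at this
    exact Event.ext_time this.1
  let vis (x y : Event h) : Prop := ∃ k k', Lin x k ∧ Lin y k' ∧ k ≤ k'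
  have closed_lin (x : closedEvents vis) : ∃ k, Lin x.1 k := by
    obtain ⟨x, y, ⟨j, v, hy⟩, hxy⟩ := x
    rcases Relation.ReflTransGen.cases_head hxy with rfl | ⟨z, ⟨k, _, hk, -⟩, -⟩
    · obtain ⟨k, op, hk, -⟩ := log_ends _ _ _ hy
      exact ⟨k, op, v, hk⟩
    · exact ⟨k, hk⟩
  choose τ hτ using closed_lin
  have τ_inj {x y : closedEvents vis} (hxy : τ x = τ y) : x = y :=
    Subtype.ext (lin_inj (hτ x) (hxy ▸ hτ y))
  have closed_of_le {x : Event h} {k : ℕ} (hx : Lin x k) (y : closedEvents vis) (hk : k ≤ τ y) :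
      x ∈ closedEvents vis := by
    obtain ⟨z, hz, hyz⟩ := y.2
    exact ⟨z, hz, .head ⟨k, τ y, hx, hτ y, hk⟩ hyz⟩
  refine ⟨vis, fun x y => τ x ≤ τ y, ?_, ?_, ?_, ?_⟩
  · exact
      { refl := fun x => le_rfl
        trans := fun x y z => le_trans
        antisymm := fun x y h₁ h₂ => τ_inj (le_antisymm h₁ h₂)
        total := fun x y => le_total _ _ }
  · rintro x y ⟨j, v, hj, hlt⟩
    obtain ⟨k, op, hk, hkj⟩ := log_ends _ _ _ hj
    have h₁ : τ x = k := lin_fun (hτ x) ⟨op, v, hk⟩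
    obtain ⟨_, _, h₂⟩ := hτ y
    have := (log_lt _ _ _ _ h₂).1
    omega
  · rintro x y ⟨k, k', hk, hk', hle⟩
    have h₁ : τ x = k := lin_fun (hτ x) hk
    have h₂ : τ y = k' := lin_fun (hτ y) hk'
    omega
  -- The closed events are those logged before the position `N`.
  have hN : ∃ N, ∀ x, τ x < N := ⟨h.length, fun x => by
    obtain ⟨_, _, h₂⟩ := hτ x
    exact (log_lt _ _ _ _ h₂).2⟩
  have closed_iff {x : Event h} {k : ℕ} (hx : Lin x k) (hk : k < Nat.find hN) :
      x ∈ closedEvents vis := by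
    have := Nat.find_min hN hk
    push Not at this
    obtain ⟨y, hy⟩ := this
    exact closed_of_le hx y hy
  have key : ∀ M ≤ Nat.find hN, ∃ (l : List (closedEvents vis)) (P : List (Op × Out)),
      (∀ x, x ∈ l ↔ τ x < M) ∧ l.Nodup ∧ l.Pairwise (fun x y => τ x ≤ τ y) ∧
      Path sem H₀ P (heap M) ∧
      List.Forall₂ (fun (x : closedEvents vis) (s : Op × Out) =>
        s.1 = x.1.op ∧ ∀ (j : ℕ) (v : Out), x.1.Ends j v → s.2 = v) l P := by
    intro M
    induction M with
    | zero => exact fun _ => ⟨[], [], by simp, .nil, .nil, heap_zero ▸ .nil _, .nil⟩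
    | succ M ih =>
      intro hM
      obtain ⟨l, P, hl, hnd, hpw, hP, hf⟩ := ih (by omega)
      rcases hlog : log M with _ | ⟨e, op, out⟩
      · refine ⟨l, P, fun x => ?_, hnd, hpw, heap_none M hlog ▸ hP, hf⟩
        have : τ x ≠ M := by
          intro hx
          obtain ⟨_, _, h₂⟩ := hτ x
          rw [hx, hlog] at h₂
          cases h₂
        rw [hl]
        omega
      · obtain ⟨t, ht⟩ := log_inv _ _ _ _ hlog
        let x₀ : Event h := ⟨e, t, op, ht⟩
        have hx₀ : Lin x₀ M := ⟨op, out, hlog⟩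
        let x₁ : closedEvents vis := ⟨x₀, closed_iff hx₀ (by omega)⟩
        have hx₁ : τ x₁ = M := lin_fun (hτ x₁) hx₀
        refine ⟨l ++ [x₁], P ++ [(op, out)], fun x => ?_, ?_, ?_, hP.snoc (heap_some _ _ _ _ hlog),
          List.rel_append hf (.cons ⟨rfl, fun j v hj => ?_⟩ .nil)⟩
        · rw [List.mem_append, List.mem_singleton, hl]
          constructor
          · rintro (hx | rfl) <;> omega
          · intro hx
            rcases Nat.lt_succ_iff_lt_or_eq.1 hx with hx | hx
            · exact .inl hx
            · exact .inr (τ_inj (hx.trans hx₁.symm))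
        · rw [List.nodup_append]
          refine ⟨hnd, List.nodup_singleton _, fun a ha b hb hab => ?_⟩
          have := (hl a).1 ha
          rw [List.mem_singleton] at hb
          subst hab hb
          omega
        · rw [List.pairwise_append]
          refine ⟨hpw, List.pairwise_singleton _ _, fun a ha b hb => ?_⟩
          have := (hl a).1 ha
          rw [List.mem_singleton] at hb
          subst hb
          omega
        · obtain ⟨k, op', hk, -⟩ := log_ends _ _ _ hj
          obtain rfl := log_inj _ _ _ _ _ _ _ hk hlog
          have := hk.symm.trans hlog
          simp only [Option.some.injEq, Prod.mk.injEq] at this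
          exact this.2.2.symm
  obtain ⟨l, P, hl, hnd, hpw, hP, hf⟩ := key _ le_rfl
  exact ⟨l, P, _, fun x => (hl x).2 (Nat.find_spec hN x), hnd, hpw, hP, hf⟩

end Concurrency

namespace RDCSS

open Concurrency

/-! ### Procedure calls that do not touch a data pointer -/

section Touches

variable {B C D : Type*}

/-- The execution of `op` with output `out` accesses the data pointer `p` of the abstract heap. -/
def Op.Touches (p : D) : Op B C D → Val B C D → Prop
  | .rdcss d, _ => d.pt2 = p
  | .rread q, _ => q = p
  | .rCAS q _ _, _ => q = p
  | .rwrite q _, _ => q = p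
  | .ralloc _ _, out => out = .ptr (.dptr p)
  | .rreadC _, _ => False
  | .rCASC _ _ _, _ => False
  | .rwriteC _ _, _ => False

theorem Heap.set_same (H : Heap B C D) (p : Ptr C D) (v : Val B C D) : H.set p v p = some v := by
  simp [Heap.set]

theorem Heap.set_of_ne (H : Heap B C D) {p q : Ptr C D} (v : Val B C D) (hqp : q ≠ p) :
    H.set p v q = H q := by
  simp [Heap.set, hqp]

theorem Heap.set_eq_self {H : Heap B C D} {p : Ptr C D} {v : Val B C D} (hp : H p = some v) :
    H.set p v = H := by
  simp [Heap.set, ← hp]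

open Classical in
theorem Heap.set_comm (H : Heap B C D) {p q : Ptr C D} (v w : Val B C D) (hpq : p ≠ q) :
    (H.set p v).set q w = (H.set q w).set p v := by
  simp only [Heap.set]
  exact Function.update_comm hpq _ _ _

/-- Executions that do not access the data pointer `p` are insensitive to its contents. -/
theorem OpStep.set_dptr {H H' : Heap B C D} {op : Op B C D} {out : Val B C D} {p : D}
    (hs : OpStep H op out H') (hp : ¬ op.Touches p out) (v : Val B C D) :
    OpStep (H.set (.dptr p) v) op out (H'.set (.dptr p) v) := by
  have hd {q : D} (hq : ¬ q = p) : H.set (.dptr p) v (.dptr q) = H (.dptr q) :=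
    H.set_of_ne v (by simpa using hq)
  have hc (q : C) : H.set (.dptr p) v (.cptr q) = H (.cptr q) := H.set_of_ne v (by simp)
  cases hs with
  | rdcss_ne d w h₁ h₂ => exact .rdcss_ne _ _ _ (hd hp ▸ h₁) h₂
  | rdcss_undo d u h₁ h₂ h₃ => exact .rdcss_undo _ _ u (hd hp ▸ h₁) (hc _ ▸ h₂) h₃
  | rdcss_set d h₁ h₂ =>
    rw [Heap.set_comm _ _ _ (by simpa [Op.Touches] using hp)]
    exact .rdcss_set _ _ (hd hp ▸ h₁) (hc _ ▸ h₂)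
  | ralloc w k q hk hq =>
    have hqp : q ≠ .dptr p := fun h => hp (by simp [Op.Touches, h])
    rw [Heap.set_comm _ _ _ hqp]
    exact .ralloc _ _ _ _ hk (by rw [Heap.set_of_ne _ _ hqp, hq])
  | rCAS_ne q e n w h₁ h₂ => exact .rCAS_ne _ _ _ _ _ (hd hp ▸ h₁) h₂
  | rCAS_eq q e n h₁ =>
    rw [Heap.set_comm _ _ _ (by simpa [Op.Touches] using hp)]
    exact .rCAS_eq _ _ _ _ (hd hp ▸ h₁)
  | rwrite q w h₁ =>
    rw [Heap.set_comm _ _ _ (by simpa [Op.Touches] using hp)]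
    exact .rwrite _ _ _ (hd hp ▸ h₁)
  | rread q w h₁ => exact .rread _ _ _ (hd hp ▸ h₁)
  | rCASC_ne q e n w h₁ h₂ => exact .rCASC_ne _ _ _ _ _ (hc _ ▸ h₁) h₂
  | rCASC_eq q e n h₁ =>
    rw [Heap.set_comm _ _ _ (by simp)]
    exact .rCASC_eq _ _ _ _ (hc _ ▸ h₁)
  | rwriteC q w h₁ =>
    rw [Heap.set_comm _ _ _ (by simp)]
    exact .rwriteC _ _ _ (hc _ ▸ h₁)
  | rreadC q w h₁ => exact .rreadC _ _ _ (hc _ ▸ h₁)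

end Touches

/-! ### Ghost state -/

/-- The progress of an event: it has not been linearized and, if it is an `rdcss`, its descriptor has
not been installed; it is an `rdcss` whose descriptor, stored at `r`, was installed in its data
pointer by the `i`-th action of the history, and still is there; it is linearized at the `k`-th
action with output `out`. -/
inductive Status (B C D R : Type*)
  | pending
  | installed (r : R) (i : ℕ)
  | linearized (k : ℕ) (out : Val B C D)

/-- Ghost state of an execution. Events are identified with their start times.
* `log k` is the event linearized at the `k`-th action, with its call and its output;
* `heap k` is the abstract heap before the `k`-th action;
* `status e` is the progress of the event `e`;
* `owner r` is the event that allocated the descriptor pointer `r`. -/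
structure Ghost (B C D R : Type*) where
  log : ℕ → Option (ℕ × Op B C D × Val B C D)
  heap : ℕ → Heap B C D
  status : ℕ → Status B C D R
  owner : R → ℕ

section Core

variable {Tid B C D R : Type*}

/-- The invariant relating the history and the memory to the ghost state. The abstract value of
a data pointer that stores a descriptor is the expected value `exp2`, and no event touching it has
been linearized since the descriptor was installed. -/
structure Core (h : List (Label Tid (Op B C D) (Val B C D))) (m : Mem B C D R)
    (g : Ghost B C D R) : Prop where
  heap_zero : g.heap 0 = emptyHeap B C D
  heap_none : ∀ k, g.log k = none → g.heap (k + 1) = g.heap k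
  heap_some : ∀ k e op out, g.log k = some (e, op, out) →
    OpStep (g.heap k) op out (g.heap (k + 1))
  log_inv : ∀ k e op out, g.log k = some (e, op, out) → ∃ t, h[e]? = some (.inv t op)
  log_status : ∀ k e op out, g.log k = some (e, op, out) → g.status e = .linearized k out
  status_log : ∀ k e out, g.status e = .linearized k out → ∃ op, g.log k = some (e, op, out)
  log_lt : ∀ k e op out, g.log k = some (e, op, out) → e < k ∧ k < h.length
  status_of_le : ∀ e, h.length ≤ e → g.status e = .pending
  ctrl : ∀ c, m.ctrl c = g.heap h.length (.cptr c)
  data_none : ∀ p, m.data p = none → g.heap h.length (.dptr p) = none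
  data_val : ∀ p v, m.data p = some (.val v) → g.heap h.length (.dptr p) = some v
  data_rdesc : ∀ p r, m.data p = some (.rdesc r) → ∃ i desc t,
    m.desc r = some desc ∧ desc.pt2 = p ∧ g.status (g.owner r) = .installed r i ∧
    g.owner r < i ∧ i < h.length ∧ h[g.owner r]? = some (.inv t (.rdcss desc)) ∧
    (∀ j, i < j → g.heap j (.dptr p) = some desc.exp2) ∧
    ∀ j e op out, i ≤ j → g.log j = some (e, op, out) → ¬ op.Touches p out
  installed : ∀ e r i, g.status e = .installed r i → g.owner r = e ∧
    ∃ desc, m.desc r = some desc ∧ m.data desc.pt2 = some (.rdesc r)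

theorem getElem?_snoc_of_some {α : Type*} {l : List α} {i : ℕ} {x : α} (y : α)
    (hx : l[i]? = some x) : (l ++ [y])[i]? = some x := by
  obtain ⟨hi, -⟩ := List.getElem?_eq_some_iff.1 hx
  rw [List.getElem?_append_left hi, hx]

theorem getElem?_snoc_eq_some {α : Type*} {l : List α} {i : ℕ} {x y : α}
    (hx : (l ++ [y])[i]? = some x) : l[i]? = some x ∨ i = l.length ∧ x = y := by
  obtain ⟨hi, -⟩ := List.getElem?_eq_some_iff.1 hx
  rw [List.length_append, List.length_singleton] at hi
  rcases Nat.lt_succ_iff_lt_or_eq.1 hi with hi | rfl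
  · rw [List.getElem?_append_left hi] at hx
    exact .inl hx
  · rw [List.getElem?_concat_length] at hx
    exact .inr ⟨rfl, (Option.some.inj hx).symm⟩

variable {h : List (Label Tid (Op B C D) (Val B C D))} {m : Mem B C D R} {g : Ghost B C D R}

namespace Core

theorem log_of_le (hc : Core h m g) {k : ℕ} (hk : h.length ≤ k) : g.log k = none := by
  rcases hlog : g.log k with _ | ⟨e, op, out⟩
  · rfl
  · have := (hc.log_lt _ _ _ _ hlog).2
    omega

theorem heap_of_le (hc : Core h m g) {k : ℕ} (hk : h.length ≤ k) :
    g.heap k = g.heap h.length := by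
  induction k, hk using Nat.le_induction with
  | base => rfl
  | succ k hk ih => rw [hc.heap_none k (hc.log_of_le hk), ih]

/-- An action that affects neither the memory nor the ghost state. -/
theorem snoc (hc : Core h m g) (l : Label Tid (Op B C D) (Val B C D)) :
    Core (h ++ [l]) m g := by
  have hlen : (h ++ [l]).length = h.length + 1 := by simp
  have hheap : g.heap (h ++ [l]).length = g.heap h.length := hc.heap_of_le (by omega)
  exact
    { heap_zero := hc.heap_zero
      heap_none := hc.heap_none
      heap_some := hc.heap_some
      log_inv := fun k e op out hk => by
        obtain ⟨t, ht⟩ := hc.log_inv _ _ _ _ hk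
        exact ⟨t, getElem?_snoc_of_some _ ht⟩
      log_status := hc.log_status
      status_log := hc.status_log
      log_lt := fun k e op out hk => by
        have := hc.log_lt _ _ _ _ hk
        omega
      status_of_le := fun e he => hc.status_of_le e (by omega)
      ctrl := fun c => by rw [hheap, hc.ctrl]
      data_none := fun p hp => by rw [hheap, hc.data_none p hp]
      data_val := fun p v hp => by rw [hheap, hc.data_val p v hp]
      data_rdesc := fun p r hp => by
        obtain ⟨i, desc, t, h₁, h₂, h₃, h₄, h₅, h₆, h₇⟩ := hc.data_rdesc p r hp
        exact ⟨i, desc, t, h₁, h₂, h₃, h₄, by omega, getElem?_snoc_of_some _ h₆, h₇⟩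
      installed := hc.installed }

open Classical in
/-- Allocation of a descriptor pointer by the event `e`. -/
theorem allocDesc (hc : Core h m g) {r : R} (hr : m.desc r = none) (desc : Desc B C D) (e : ℕ) :
    Core h (m.setDesc r desc) { g with owner := Function.update g.owner r e } := by
  have hne {r' : R} {d : Desc B C D} (hr' : m.desc r' = some d) : r' ≠ r := by
    rintro rfl
    rw [hr] at hr'
    cases hr'
  exact
    { hc with
      data_rdesc := fun p r' hp => by
        obtain ⟨i, d, t, h₁, h₂⟩ := hc.data_rdesc p r' hp
        refine ⟨i, d, t, ?_, ?_⟩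
        · simpa [Mem.setDesc, hne h₁] using h₁
        · simpa [Function.update_of_ne (hne h₁)] using h₂
      installed := fun e' r' i he' => by
        obtain ⟨h₁, d, h₂, h₃⟩ := hc.installed e' r' i he'
        refine ⟨?_, d, ?_, h₃⟩
        · simpa [Function.update_of_ne (hne h₂)] using h₁
        · simpa [Mem.setDesc, hne h₂] using h₂ }

open Classical in
/-- The current action installs the descriptor of the event `e`. -/
theorem install (hc : Core h m g) {r : R} {desc : Desc B C D} {e : ℕ} {t : Tid}
    (l : Label Tid (Op B C D) (Val B C D)) (hr : m.desc r = some desc)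
    (hp : m.data desc.pt2 = some (.val desc.exp2)) (hown : g.owner r = e)
    (hst : g.status e = .pending) (he : h[e]? = some (.inv t (.rdcss desc))) :
    Core (h ++ [l]) (m.setData desc.pt2 (.rdesc r))
      { g with status := Function.update g.status e (.installed r h.length) } := by
  have hlt : e < h.length := (List.getElem?_eq_some_iff.1 he).1
  have hlen : (h ++ [l]).length = h.length + 1 := by simp
  have hc' := hc.snoc l
  have hdata (q : D) (w : Word B C D R) (hw : w ≠ .rdesc r)
      (hq : (m.setData desc.pt2 (.rdesc r)).data q = some w) : m.data q = some w := by
    by_cases hqp : q = desc.pt2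
    · subst hqp
      simp [Mem.setData, Ne.symm hw] at hq
    · simpa [Mem.setData, hqp] using hq
  exact
    { hc' with
      log_status := fun k e' op out hk => by
        have := hc.log_status _ _ _ _ hk
        have hne : e' ≠ e := by
          rintro rfl
          rw [hst] at this
          cases this
        simpa [Function.update_of_ne hne] using this
      status_log := fun k e' out hk => by
        have hne : e' ≠ e := by
          rintro rfl
          simp at hk
        simp only [Function.update_of_ne hne] at hk
        exact hc.status_log _ _ _ hk
      status_of_le := fun e' he' => by
        have hne : e' ≠ e := by omega
        simpa [Function.update_of_ne hne] using hc'.status_of_le e' he'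
      data_none := fun q hq => by
        refine hc'.data_none q ?_
        by_cases hqp : q = desc.pt2
        · simp [Mem.setData, hqp] at hq
        · simpa [Mem.setData, hqp] using hq
      data_val := fun q v hq => hc'.data_val q v (hdata q _ (by simp) hq)
      data_rdesc := fun q r' hq => by
        by_cases hqp : q = desc.pt2
        · subst hqp
          simp only [Mem.setData, Function.update_self, Option.some.injEq, Word.rdesc.injEq] at hq
          subst hq hown
          refine ⟨h.length, desc, t, hr, rfl, by simp, hlt, by omega, getElem?_snoc_of_some _ he,
            fun j hj => ?_, fun j e op out hj hlog => ?_⟩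
          · rw [hc.heap_of_le hj.le]
            exact hc.data_val _ _ hp
          · rw [hc.log_of_le hj] at hlog
            cases hlog
        · have hq' : m.data q = some (.rdesc r') := by simpa [Mem.setData, hqp] using hq
          obtain ⟨i, d, t', h₁, h₂, h₃, h₄⟩ := hc'.data_rdesc q r' hq'
          have hne : g.owner r' ≠ e := by
            intro hre
            rw [hre, hst] at h₃
            cases h₃
          exact ⟨i, d, t', h₁, h₂, by simpa [Function.update_of_ne hne] using h₃, h₄⟩
      installed := fun e' r' i he' => by
        by_cases hne : e' = e
        · subst hne
          simp only [Function.update_self, Status.installed.injEq] at he'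
          obtain ⟨rfl, -⟩ := he'
          exact ⟨hown, desc, hr, by simp [Mem.setData]⟩
        · simp only [Function.update_of_ne hne] at he'
          obtain ⟨h₁, d, h₂, h₃⟩ := hc.installed e' r' i he'
          refine ⟨h₁, d, h₂, ?_⟩
          have hdp : d.pt2 ≠ desc.pt2 := by
            intro hdp
            rw [hdp, hp] at h₃
            cases h₃
          simpa [Mem.setData, hdp] using h₃ }

end Core

end Core

/-! ### Linearizing an event -/

section Linearize

variable {Tid B C D R : Type*} {h : List (Label Tid (Op B C D) (Val B C D))}
  {m : Mem B C D R} {g : Ghost B C D R}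

/-- Linearize the event `e` at the `j`-th action; `F` is the effect of doing so on the abstract heaps
after that action. -/
def Ghost.insert (g : Ghost B C D R) (j e : ℕ) (op : Op B C D) (out : Val B C D)
    (F : Heap B C D → Heap B C D) : Ghost B C D R where
  log := Function.update g.log j (some (e, op, out))
  heap k := if k ≤ j then g.heap k else F (g.heap k)
  status := Function.update g.status e (.linearized j out)
  owner := g.owner

theorem Ghost.insert_heap_of_le (g : Ghost B C D R) {j k : ℕ} (e : ℕ) (op : Op B C D)
    (out : Val B C D) (F : Heap B C D → Heap B C D) (hk : k ≤ j) :
    (g.insert j e op out F).heap k = g.heap k :=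
  if_pos hk

theorem Ghost.insert_heap_of_lt (g : Ghost B C D R) {j k : ℕ} (e : ℕ) (op : Op B C D)
    (out : Val B C D) (F : Heap B C D → Heap B C D) (hk : j < k) :
    (g.insert j e op out F).heap k = F (g.heap k) :=
  if_neg (by omega)

/-- The current action linearizes the event `e`, possibly at an earlier position `j` of the log, if
the events linearized after that position can still be executed. -/
theorem Core.insert (hc : Core h m g) {m' : Mem B C D R} {j e : ℕ} {t : Tid} {op : Op B C D}
    {out : Val B C D} {F : Heap B C D → Heap B C D} (l : Label Tid (Op B C D) (Val B C D))
    (hj : g.log j = none) (hej : e < j) (hjh : j ≤ h.length) (he : h[e]? = some (.inv t op))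
    (hst : ∀ k w, g.status e ≠ .linearized k w)
    (hs : OpStep (g.heap j) op out (F (g.heap j)))
    (hF : ∀ k e' op' out', j < k → g.log k = some (e', op', out') →
      OpStep (F (g.heap k)) op' out' (F (g.heap (k + 1))))
    (hdesc : m'.desc = m.desc) (hctrl : ∀ c, m'.ctrl c = F (g.heap h.length) (.cptr c))
    (hdata : ∀ p,
      (m'.data p = m.data p ∧ (∀ k, j ≤ k → F (g.heap k) (.dptr p) = g.heap k (.dptr p)) ∧
        ¬ op.Touches p out ∧ ∀ r, m.data p = some (.rdesc r) → g.owner r ≠ e) ∨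
      ∃ v, m'.data p = some (.val v) ∧ F (g.heap h.length) (.dptr p) = some v ∧
        ∀ r, m.data p = some (.rdesc r) → g.owner r = e) :
    Core (h ++ [l]) m' (g.insert j e op out F) := by
  have hlen : (h ++ [l]).length = h.length + 1 := by simp
  have hc' := hc.snoc l
  have hheap : (g.insert j e op out F).heap (h ++ [l]).length = F (g.heap h.length) := by
    rw [g.insert_heap_of_lt _ _ _ _ (by omega), hc.heap_of_le (by omega)]
  have hlog {k e' op' out'} (hk : (g.insert j e op out F).log k = some (e', op', out')) :
      (k = j ∧ e' = e ∧ op' = op ∧ out' = out) ∨ (k ≠ j ∧ g.log k = some (e', op', out')) := by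
    by_cases hkj : k = j
    · subst hkj
      simp only [Ghost.insert, Function.update_self, Option.some.injEq, Prod.mk.injEq] at hk
      exact .inl ⟨rfl, hk.1.symm, hk.2.1.symm, hk.2.2.symm⟩
    · refine .inr ⟨hkj, ?_⟩
      simpa [Ghost.insert, hkj] using hk
  have hne {k e' op' out'} (hk : g.log k = some (e', op', out')) : e' ≠ e := by
    rintro rfl
    exact hst _ _ (hc.log_status _ _ _ _ hk)
  have hstatus {e'} (he' : e' ≠ e) : (g.insert j e op out F).status e' = g.status e' :=
    Function.update_of_ne he' _ _
  exact
    { heap_zero := by rw [g.insert_heap_of_le _ _ _ _ (Nat.zero_le _), hc.heap_zero]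
      heap_none := fun k hk => by
        have hkj : k ≠ j := by
          rintro rfl
          simp [Ghost.insert] at hk
        have hk' : g.log k = none := by simpa [Ghost.insert, hkj] using hk
        rcases Nat.lt_or_gt_of_ne hkj with hlt | hlt
        · rw [g.insert_heap_of_le _ _ _ _ hlt, g.insert_heap_of_le _ _ _ _ hlt.le,
            hc.heap_none k hk']
        · rw [g.insert_heap_of_lt _ _ _ _ hlt, g.insert_heap_of_lt _ _ _ _ (by omega),
            hc.heap_none k hk']
      heap_some := fun k e' op' out' hk => by
        rcases hlog hk with ⟨rfl, rfl, rfl, rfl⟩ | ⟨hkj, hk'⟩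
        · rw [g.insert_heap_of_le _ _ _ _ le_rfl, g.insert_heap_of_lt _ _ _ _ (by omega),
            hc.heap_none k hj]
          exact hs
        rcases Nat.lt_or_gt_of_ne hkj with hlt | hlt
        · rw [g.insert_heap_of_le _ _ _ _ hlt, g.insert_heap_of_le _ _ _ _ hlt.le]
          exact hc.heap_some _ _ _ _ hk'
        · rw [g.insert_heap_of_lt _ _ _ _ hlt, g.insert_heap_of_lt _ _ _ _ (by omega)]
          exact hF _ _ _ _ hlt hk'
      log_inv := fun k e' op' out' hk => by
        rcases hlog hk with ⟨rfl, rfl, rfl, rfl⟩ | ⟨-, hk'⟩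
        · exact ⟨t, getElem?_snoc_of_some _ he⟩
        · exact hc'.log_inv _ _ _ _ hk'
      log_status := fun k e' op' out' hk => by
        rcases hlog hk with ⟨rfl, rfl, rfl, rfl⟩ | ⟨-, hk'⟩
        · simp [Ghost.insert]
        · rw [hstatus (hne hk'), hc.log_status _ _ _ _ hk']
      status_log := fun k e' out' hk => by
        by_cases hee : e' = e
        · subst hee
          simp only [Ghost.insert, Function.update_self, Status.linearized.injEq] at hk
          obtain ⟨rfl, rfl⟩ := hk
          exact ⟨op, by simp [Ghost.insert]⟩
        · rw [hstatus hee] at hk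
          obtain ⟨op', hk'⟩ := hc.status_log _ _ _ hk
          have hkj : k ≠ j := by
            rintro rfl
            rw [hj] at hk'
            cases hk'
          exact ⟨op', by simpa [Ghost.insert, hkj] using hk'⟩
      log_lt := fun k e' op' out' hk => by
        rcases hlog hk with ⟨rfl, rfl, rfl, rfl⟩ | ⟨-, hk'⟩
        · omega
        · exact hc'.log_lt _ _ _ _ hk'
      status_of_le := fun e' he' => by
        rw [hstatus (by omega), hc'.status_of_le e' he']
      ctrl := fun c => by rw [hheap, hctrl]
      data_none := fun p hp => by
        rw [hheap]
        rcases hdata p with ⟨h₁, h₂, -⟩ | ⟨v, h₁, -⟩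
        · rw [h₂ _ hjh, hc.data_none p (h₁ ▸ hp)]
        · rw [h₁] at hp
          cases hp
      data_val := fun p v hp => by
        rw [hheap]
        rcases hdata p with ⟨h₁, h₂, -⟩ | ⟨v', h₁, h₂, -⟩
        · rw [h₂ _ hjh, hc.data_val p v (h₁ ▸ hp)]
        · rw [h₁] at hp
          simp only [Option.some.injEq, Word.val.injEq] at hp
          rw [h₂, hp]
      data_rdesc := fun p r hp => by
        rcases hdata p with ⟨h₁, h₂, h₃, h₄⟩ | ⟨v', h₁, h₂, -⟩
        · rw [h₁] at hp
          obtain ⟨i, desc, t', k₁, k₂, k₃, k₄, k₅, k₆, k₇, k₈⟩ := hc'.data_rdesc p r hp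
          refine ⟨i, desc, t', hdesc ▸ k₁, k₂, (hstatus (h₄ r hp)).trans k₃, k₄, k₅, k₆,
            fun k hk => ?_, fun k e' op' out' hk hlk => ?_⟩
          · rcases le_or_gt k j with hkj | hkj
            · rw [g.insert_heap_of_le _ _ _ _ hkj, k₇ k hk]
            · rw [g.insert_heap_of_lt _ _ _ _ hkj, h₂ k hkj.le, k₇ k hk]
          · rcases hlog hlk with ⟨rfl, rfl, rfl, rfl⟩ | ⟨-, hk'⟩
            · exact h₃
            · exact k₈ _ _ _ _ hk hk'
        · rw [h₁] at hp
          cases hp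
      installed := fun e' r i he' => by
        have hee : e' ≠ e := by
          rintro rfl
          simp [Ghost.insert] at he'
        rw [hstatus hee] at he'
        obtain ⟨h₁, d, h₂, h₃⟩ := hc.installed _ _ _ he'
        refine ⟨h₁, d, hdesc ▸ h₂, ?_⟩
        rcases hdata d.pt2 with ⟨k₁, -⟩ | ⟨v', -, -, k₁⟩
        · rw [k₁, h₃]
        · exact absurd (h₁.symm.trans (k₁ r h₃)) hee }

/-- The current action linearizes the event `e` at this moment. -/
theorem Core.linearize (hc : Core h m g) {m' : Mem B C D R} {e : ℕ} {t : Tid} {op : Op B C D}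
    {out : Val B C D} {H' : Heap B C D} (l : Label Tid (Op B C D) (Val B C D))
    (he : h[e]? = some (.inv t op)) (hst : g.status e = .pending)
    (hs : OpStep (g.heap h.length) op out H')
    (hdesc : m'.desc = m.desc) (hctrl : ∀ c, m'.ctrl c = H' (.cptr c))
    (hdata : ∀ p,
      (m'.data p = m.data p ∧ H' (.dptr p) = g.heap h.length (.dptr p) ∧ ¬ op.Touches p out) ∨
      ∃ v, m'.data p = some (.val v) ∧ H' (.dptr p) = some v ∧
        ∀ r, m.data p ≠ some (.rdesc r)) :
    Core (h ++ [l]) m' (g.insert h.length e op out fun _ => H') := by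
  have hlt : e < h.length := (List.getElem?_eq_some_iff.1 he).1
  refine hc.insert l (hc.log_of_le le_rfl) hlt le_rfl he (by simp [hst]) hs
    (fun k _ _ _ hk hlog => ?_) hdesc hctrl fun p => ?_
  · rw [hc.log_of_le hk.le] at hlog
    cases hlog
  · refine (hdata p).imp (fun ⟨h₁, h₂, h₃⟩ => ⟨h₁, fun k hk => ?_, h₃, fun r hr hown => ?_⟩)
      (fun ⟨v, h₁, h₂, h₃⟩ => ⟨v, h₁, h₂, fun r hr => absurd hr (h₃ r)⟩)
    · rw [h₂, hc.heap_of_le hk]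
    · obtain ⟨i, desc, t', -, -, h₄, -⟩ := hc.data_rdesc p r hr
      rw [hown, hst] at h₄
      cases h₄

/-- The current action replaces an installed descriptor by the value `v`, which linearizes its owner
retroactively: at the `j`-th action, when the control pointer justified writing `v`. -/
theorem Core.resolve (hc : Core h m g) {r : R} {desc : Desc B C D} {i j : ℕ} {u v : Val B C D}
    (l : Label Tid (Op B C D) (Val B C D)) (hr : m.desc r = some desc)
    (hp : m.data desc.pt2 = some (.rdesc r)) (hst : g.status (g.owner r) = .installed r i)
    (hij : i < j) (hjh : j < h.length) (hj : g.log j = none)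
    (hu : g.heap j (.cptr desc.pt1) = some u)
    (huv : u = desc.exp1 ∧ v = desc.new2 ∨ u ≠ desc.exp1 ∧ v = desc.exp2) :
    Core (h ++ [l]) (m.setData desc.pt2 (.val v))
      (g.insert j (g.owner r) (.rdcss desc) desc.exp2 fun H => H.set (.dptr desc.pt2) v) := by
  obtain ⟨i', desc', t, h₁, -, h₃, h₄, h₅, h₆, h₇, h₈⟩ := hc.data_rdesc _ _ hp
  obtain rfl : desc = desc' := by simpa [hr] using h₁
  obtain rfl : i = i' := by simpa [hst] using h₃
  refine hc.insert l hj (by omega) hjh.le h₆ (by simp [hst]) ?_ (fun k e' op' out' hk hlog => ?_)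
    rfl (fun c => ?_) fun p => ?_
  · rcases huv with ⟨rfl, rfl⟩ | ⟨hne, rfl⟩
    · exact .rdcss_set _ _ (h₇ j hij) hu
    · -- The abstract value already was `exp2`, so writing it back does not change the heap.
      rw [Heap.set_eq_self (h₇ j hij)]
      exact .rdcss_undo _ _ _ (h₇ j hij) hu hne
  · exact (hc.heap_some _ _ _ _ hlog).set_dptr (h₈ _ _ _ _ (by omega) hlog) v
  · rw [Heap.set_of_ne _ _ (by simp)]
    exact hc.ctrl c
  · by_cases hpp : p = desc.pt2
    · subst hpp
      refine .inr ⟨v, by simp [Mem.setData], Heap.set_same _ _ _, fun r' hr' => ?_⟩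
      obtain rfl : r = r' := by simpa [hp] using hr'
      rfl
    · refine .inl ⟨by simp [Mem.setData, hpp], fun k _ => Heap.set_of_ne _ _ (by simpa using hpp),
        Ne.symm hpp, fun r' hr' hown => ?_⟩
      obtain ⟨i', desc', t, k₁, k₂, k₃, -⟩ := hc.data_rdesc _ _ hr'
      rw [hown, hst] at k₃
      simp only [Status.installed.injEq] at k₃
      obtain ⟨rfl, -⟩ := k₃
      obtain rfl : desc = desc' := by simpa [hr] using k₁
      exact hpp k₂.symm

end Linearize

/-! ### What a thread knows at each program point -/

section Points

variable {Tid B C D R : Type*}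

/-- The invariant of the event `e`, with call `op`, at the program points outside `complete` and
before the procedure returns: the event is not linearized. -/
def StartOK (g : Ghost B C D R) (md : R → Option (Desc B C D)) (e : ℕ) (op : Op B C D) :
    PC B C D R → Prop
  | .rdcssAlloc desc => op = .rdcss desc ∧ g.status e = .pending
  | .loopCAS d desc =>
    op = .rdcss desc ∧ g.status e = .pending ∧ g.owner d = e ∧ md d = some desc
  | .rreadRead pt => op = .rread pt ∧ g.status e = .pending
  | .rCASCAS pt exp new => op = .rCAS pt exp new ∧ g.status e = .pending
  | .rwriteRead pt v => op = .rwrite pt v ∧ g.status e = .pending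
  | .rwriteCAS pt _ v => op = .rwrite pt v ∧ g.status e = .pending
  | .rreadC pt => op = .rreadC pt ∧ g.status e = .pending
  | .rCASC pt exp new => op = .rCASC pt exp new ∧ g.status e = .pending
  | .rwriteC pt v => op = .rwriteC pt v ∧ g.status e = .pending
  | .rallocCtrl v => op = .ralloc v .cptr ∧ g.status e = .pending
  | .rallocData v => op = .ralloc v .dptr ∧ g.status e = .pending
  | _ => False

/-- The invariant of the event `e` while it executes `complete r` with continuation `k`. If `k`
returns, then `r` is the descriptor of `e` itself. -/
def ContOK (g : Ghost B C D R) (md : R → Option (Desc B C D)) (r : R) (e : ℕ) (op : Op B C D) :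
    PC B C D R → Prop
  | .ret out => (∃ desc, md r = some desc ∧ out = desc.exp2) ∧
    ((∃ i, g.status e = .installed r i) ∨ ∃ k, g.status e = .linearized k out)
  | k => StartOK g md e op k

/-- The descriptor pointer `r` is or was installed. -/
def WasInstalled (g : Ghost B C D R) (md : R → Option (Desc B C D)) (r : R) : Prop :=
  md r ≠ none ∧ g.status (g.owner r) ≠ .pending

/-- A linearization point is available for the owner of `r` in case `r` still is installed: after the
installation, some thread read a value with property `P` from the control pointer `c` in order to
complete `r`, and the log is empty at that position. -/
def Reserved (g : Ghost B C D R) (readBy : ℕ → Option R) (n : ℕ) (r : R) (c : C)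
    (P : Val B C D → Prop) : Prop :=
  ∀ i, g.status (g.owner r) = .installed r i →
    ∃ j u, readBy j = some r ∧ i < j ∧ j < n ∧ g.log j = none ∧ g.heap j (.cptr c) = some u ∧ P u

/-- The invariant of the event `e`, with call `op`, at a program point. Here `readBy j` is the
descriptor pointer for which the `j`-th action reads a control pointer in `complete`, and `n` is the
number of actions so far. -/
def PointOK (g : Ghost B C D R) (readBy : ℕ → Option R) (n : ℕ) (md : R → Option (Desc B C D))
    (e : ℕ) (op : Op B C D) : PC B C D R → Prop
  | .ret out => ∃ k, g.status e = .linearized k out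
  | .completeReadDesc r k => WasInstalled g md r ∧ ContOK g md r e op k
  | .completeReadPt1 r desc k => WasInstalled g md r ∧ ContOK g md r e op k ∧ md r = some desc
  | .completeCASNew r desc k => WasInstalled g md r ∧ ContOK g md r e op k ∧ md r = some desc ∧
    Reserved g readBy n r desc.pt1 (· = desc.exp1)
  | .completeCASExp r desc k => WasInstalled g md r ∧ ContOK g md r e op k ∧ md r = some desc ∧
    Reserved g readBy n r desc.pt1 (· ≠ desc.exp1)
  | pc => StartOK g md e op pc

/-- How an action may change the ghost state and the descriptors: events make progress, the contents
of control pointers in the past are fixed, and the positions of the log at which a descriptor was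
read are left empty as long as it is installed. -/
structure Evolves (g : Ghost B C D R) (rb : ℕ → Option R) (n : ℕ)
    (md : R → Option (Desc B C D)) (g' : Ghost B C D R) (rb' : ℕ → Option R)
    (md' : R → Option (Desc B C D)) : Prop where
  installed : ∀ e r i, g.status e = .installed r i → g'.status e = .installed r i ∨
    ∃ desc k, md r = some desc ∧ g'.status e = .linearized k desc.exp2
  linearized : ∀ e k out, g.status e = .linearized k out → g'.status e = .linearized k out
  desc : ∀ r d, md r = some d → md' r = some d
  owner : ∀ r, md r ≠ none → g'.owner r = g.owner r
  readBy : ∀ j r, j < n → rb j = some r → rb' j = some r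
  log : ∀ j r i, j < n → rb j = some r → g.log j = none →
    g'.status (g.owner r) = .installed r i → g'.log j = none
  ctrl : ∀ j c, j < n → g'.heap j (.cptr c) = g.heap j (.cptr c)

variable {g g' : Ghost B C D R} {rb rb' : ℕ → Option R} {n : ℕ} {md md' : R → Option (Desc B C D)}
  {e : ℕ} {op : Op B C D}

theorem Evolves.refl (g : Ghost B C D R) (rb : ℕ → Option R) (n : ℕ)
    (md : R → Option (Desc B C D)) : Evolves g rb n md g rb md :=
  ⟨fun _ _ _ => .inl, fun _ _ _ => id, fun _ _ => id, fun _ _ => rfl, fun _ _ _ => id,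
    fun _ _ _ _ _ h _ => h, fun _ _ _ => rfl⟩

theorem Evolves.ne_pending (ev : Evolves g rb n md g' rb' md') {x : ℕ}
    (hx : g.status x ≠ .pending) : g'.status x ≠ .pending := by
  rcases hst : g.status x with _ | ⟨r, i⟩ | ⟨k, out⟩
  · exact absurd hst hx
  · rcases ev.installed _ _ _ hst with h | ⟨_, _, -, h⟩ <;> simp [h]
  · simp [ev.linearized _ _ _ hst]

theorem Evolves.installed_of_ne_pending (ev : Evolves g rb n md g' rb' md') {x : ℕ} {r : R} {i : ℕ}
    (hx : g.status x ≠ .pending) (hx' : g'.status x = .installed r i) :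
    g.status x = .installed r i := by
  rcases hst : g.status x with _ | ⟨r, i⟩ | ⟨k, out⟩
  · exact absurd hst hx
  · rcases ev.installed _ _ _ hst with h | ⟨_, _, -, h⟩
    · rw [← h, hx']
    · rw [h] at hx'
      cases hx'
  · rw [ev.linearized _ _ _ hst] at hx'
    cases hx'

theorem StartOK.mono {pc : PC B C D R} (h : StartOK g md e op pc)
    (ev : Evolves g rb n md g' rb' md') (he : g.status e = .pending → g'.status e = .pending) :
    StartOK g' md' e op pc := by
  cases pc with
  | loopCAS d desc =>
    obtain ⟨h₁, h₂, h₃, h₄⟩ := h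
    exact ⟨h₁, he h₂, (ev.owner d (by simp [h₄])).trans h₃, ev.desc _ _ h₄⟩
  | ret | completeReadDesc | completeReadPt1 | completeCASNew | completeCASExp => exact h.elim
  | _ => exact ⟨h.1, he h.2⟩

theorem ContOK.mono {r : R} {k : PC B C D R} (h : ContOK g md r e op k)
    (ev : Evolves g rb n md g' rb' md') (he : g.status e = .pending → g'.status e = .pending) :
    ContOK g' md' r e op k := by
  cases k with
  | ret out =>
    obtain ⟨⟨desc, h₁, rfl⟩, h₂⟩ := h
    refine ⟨⟨desc, ev.desc _ _ h₁, rfl⟩, ?_⟩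
    rcases h₂ with ⟨i, hi⟩ | ⟨k, hk⟩
    · rcases ev.installed _ _ _ hi with h | ⟨d, k, hd, hk⟩
      · exact .inl ⟨i, h⟩
      · obtain rfl : desc = d := by simpa [h₁] using hd
        exact .inr ⟨k, hk⟩
    · exact .inr ⟨k, ev.linearized _ _ _ hk⟩
  | _ =>
    simp only [ContOK] at h ⊢
    exact h.mono ev he

/-- What a thread knows when `complete r` returns, which it does only after `r` was removed. -/
theorem ContOK.pointOK {r : R} {k : PC B C D R} (h : ContOK g md r e op k)
    (hr : ∀ i, g.status e ≠ .installed r i) : PointOK g rb n md e op k := by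
  cases k with
  | ret out => exact h.2.resolve_left fun ⟨i, hi⟩ => hr i hi
  | completeReadDesc | completeReadPt1 | completeCASNew | completeCASExp => exact h.elim
  | _ => exact h

theorem WasInstalled.mono {r : R} (h : WasInstalled g md r) (ev : Evolves g rb n md g' rb' md') :
    WasInstalled g' md' r := by
  refine ⟨?_, ?_⟩
  · obtain ⟨d, hd⟩ := Option.ne_none_iff_exists'.1 h.1
    simp [ev.desc _ _ hd]
  · rw [ev.owner r h.1]
    exact ev.ne_pending h.2

theorem Reserved.mono {r : R} {c : C} {P : Val B C D → Prop} (h : Reserved g rb n r c P)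
    (hr : WasInstalled g md r) (ev : Evolves g rb n md g' rb' md') :
    Reserved g' rb' (n + 1) r c P := by
  intro i hi
  rw [ev.owner r hr.1] at hi
  obtain ⟨j, u, h₁, h₂, h₃, h₄, h₅, h₆⟩ := h i (ev.installed_of_ne_pending hr.2 hi)
  exact ⟨j, u, ev.readBy _ _ h₃ h₁, h₂, by omega, ev.log _ _ _ h₃ h₁ h₄ hi,
    (ev.ctrl _ _ h₃).trans h₅, h₆⟩

/-- What a thread knows is not invalidated by the actions of the other threads. -/
theorem PointOK.mono {pc : PC B C D R} (h : PointOK g rb n md e op pc)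
    (ev : Evolves g rb n md g' rb' md') (he : g.status e = .pending → g'.status e = .pending) :
    PointOK g' rb' (n + 1) md' e op pc := by
  cases pc with
  | ret out =>
    obtain ⟨k, hk⟩ := h
    exact ⟨k, ev.linearized _ _ _ hk⟩
  | completeReadDesc r k => exact ⟨h.1.mono ev, h.2.mono ev he⟩
  | completeReadPt1 r desc k => exact ⟨h.1.mono ev, h.2.1.mono ev he, ev.desc _ _ h.2.2⟩
  | completeCASNew r desc k =>
    exact ⟨h.1.mono ev, h.2.1.mono ev he, ev.desc _ _ h.2.2.1, h.2.2.2.mono h.1 ev⟩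
  | completeCASExp r desc k =>
    exact ⟨h.1.mono ev, h.2.1.mono ev he, ev.desc _ _ h.2.2.1, h.2.2.2.mono h.1 ev⟩
  | _ =>
    simp only [PointOK] at h ⊢
    exact h.mono ev he

theorem Evolves.insert {j x : ℕ} {out : Val B C D} {F : Heap B C D → Heap B C D}
    (op : Op B C D)
    (hx : g.status x = .pending ∨
      ∃ r i desc, g.status x = .installed r i ∧ md r = some desc ∧ out = desc.exp2)
    (hF : ∀ k c, j < k → k < n → F (g.heap k) (.cptr c) = g.heap k (.cptr c))
    (hrb : ∀ r, j < n → rb j = some r → g.owner r = x) :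
    Evolves g rb n md (g.insert j x op out F) rb md where
  installed e r i he := by
    by_cases hex : e = x
    · subst hex
      rcases hx with hx | ⟨r', i', desc, h₁, h₂, rfl⟩
      · rw [hx] at he
        cases he
      · rw [h₁] at he
        cases he
        exact .inr ⟨desc, j, h₂, by simp [Ghost.insert]⟩
    · exact .inl (by simpa [Ghost.insert, hex] using he)
  linearized e k w he := by
    by_cases hex : e = x
    · subst hex
      rcases hx with hx | ⟨r', i', desc, h₁, h₂, rfl⟩
      · rw [hx] at he
        cases he
      · rw [h₁] at he
        cases he
    · simpa [Ghost.insert, hex] using he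
  desc _ _ := id
  owner _ _ := rfl
  readBy _ _ _ := id
  log k r i hk hr hlog hst := by
    have hkj : k ≠ j := by
      rintro rfl
      rw [hrb r hk hr] at hst
      simp [Ghost.insert] at hst
    simpa [Ghost.insert, hkj] using hlog
  ctrl k c hk := by
    rcases le_or_gt k j with hkj | hkj
    · rw [g.insert_heap_of_le _ _ _ _ hkj]
    · rw [g.insert_heap_of_lt _ _ _ _ hkj, hF k c hkj hk]

/-! ### The effects of the primitives -/

variable {h : List (Label Tid (Op B C D) (Val B C D))} {m m' : Mem B C D R} {t : Tid}

/-- A thread that finds a descriptor pointer in a data pointer may complete it. -/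
theorem Core.wasInstalled (hc : Core h m g) {p : D} {r : R} (hp : m.data p = some (.rdesc r)) :
    WasInstalled g m.desc r := by
  obtain ⟨i, desc, t, h₁, -, h₂, -⟩ := hc.data_rdesc _ _ hp
  exact ⟨by simp [h₁], by simp [h₂]⟩

/-- The current action changes the memory to `m'` and takes the thread executing the event `e` to
`pc'`, and the ghost state can be updated accordingly. -/
def Advances (h : List (Label Tid (Op B C D) (Val B C D))) (m : Mem B C D R) (g : Ghost B C D R)
    (rb : ℕ → Option R) (e : ℕ) (op : Op B C D) (l : Label Tid (Op B C D) (Val B C D))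
    (m' : Mem B C D R) (pc' : PC B C D R) : Prop :=
  ∃ g' rb', Core (h ++ [l]) m' g' ∧ PointOK g' rb' (h.length + 1) m'.desc e op pc' ∧
    Evolves g rb h.length m.desc g' rb' m'.desc ∧
    ∀ x ≠ e, g.status x = .pending → g'.status x = .pending

variable (l : Label Tid (Op B C D) (Val B C D))

theorem Core.advances_silent (hc : Core h m g) {pc' : PC B C D R}
    (hpc : PointOK g rb (h.length + 1) m.desc e op pc') : Advances h m g rb e op l m pc' :=
  ⟨g, rb, hc.snoc l, hpc, .refl _ _ _ _, fun _ _ => id⟩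

theorem Core.advances_linearize (hc : Core h m g) {out : Val B C D} {H' : Heap B C D}
    (he : h[e]? = some (.inv t op)) (hst : g.status e = .pending)
    (hs : OpStep (g.heap h.length) op out H')
    (hdesc : m'.desc = m.desc) (hctrl : ∀ c, m'.ctrl c = H' (.cptr c))
    (hdata : ∀ p,
      (m'.data p = m.data p ∧ H' (.dptr p) = g.heap h.length (.dptr p) ∧ ¬ op.Touches p out) ∨
      ∃ v, m'.data p = some (.val v) ∧ H' (.dptr p) = some v ∧
        ∀ r, m.data p ≠ some (.rdesc r)) :
    Advances h m g rb e op l m' (.ret out) := by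
  refine ⟨_, rb, hc.linearize l he hst hs hdesc hctrl hdata,
    ⟨h.length, by simp [Ghost.insert]⟩, ?_, fun x hx hp => ?_⟩
  · rw [hdesc]
    exact .insert _ (.inl hst) (fun k c hk hk' => by omega) (fun r hr => by omega)
  · simpa [Ghost.insert, hx] using hp

theorem Core.advances_linearize_read (hc : Core h m g) {out : Val B C D}
    (he : h[e]? = some (.inv t op)) (hst : g.status e = .pending)
    (hs : OpStep (g.heap h.length) op out (g.heap h.length))
    (ht : ∀ p, op.Touches p out → ∃ v, m.data p = some (.val v)) :
    Advances h m g rb e op l m (.ret out) := by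
  refine hc.advances_linearize l he hst hs rfl hc.ctrl fun p => ?_
  by_cases hp : op.Touches p out
  · obtain ⟨v, hv⟩ := ht p hp
    exact .inr ⟨v, hv, hc.data_val _ _ hv, by simp [hv]⟩
  · exact .inl ⟨rfl, rfl, hp⟩

theorem Core.advances_linearize_data (hc : Core h m g) {out : Val B C D} {p : D} {v : Val B C D}
    (he : h[e]? = some (.inv t op)) (hst : g.status e = .pending)
    (hs : OpStep (g.heap h.length) op out ((g.heap h.length).set (.dptr p) v))
    (hp : ∀ r, m.data p ≠ some (.rdesc r)) (ht : ∀ q, op.Touches q out → p = q) :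
    Advances h m g rb e op l (m.setData p (.val v)) (.ret out) := by
  refine hc.advances_linearize l he hst hs rfl (fun c => ?_) fun q => ?_
  · rw [Heap.set_of_ne _ _ (by simp)]
    exact hc.ctrl c
  · by_cases hq : q = p
    · subst hq
      exact .inr ⟨v, by simp [Mem.setData], Heap.set_same _ _ _, hp⟩
    · exact .inl ⟨by simp [Mem.setData, hq], Heap.set_of_ne _ _ (by simpa using hq),
        fun h => hq (ht q h).symm⟩

theorem Core.advances_linearize_ctrl (hc : Core h m g) {out : Val B C D} {c : C} {v : Val B C D}
    (he : h[e]? = some (.inv t op)) (hst : g.status e = .pending)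
    (hs : OpStep (g.heap h.length) op out ((g.heap h.length).set (.cptr c) v))
    (ht : ∀ q, ¬ op.Touches q out) :
    Advances h m g rb e op l (m.setCtrl c v) (.ret out) := by
  refine hc.advances_linearize l he hst hs rfl (fun c' => ?_) fun q => ?_
  · by_cases hcc : c' = c
    · subst hcc
      rw [Heap.set_same]
      simp [Mem.setCtrl]
    · rw [Heap.set_of_ne _ _ (by simpa using hcc), ← hc.ctrl]
      simp [Mem.setCtrl, hcc]
  · exact .inl ⟨rfl, Heap.set_of_ne _ _ (by simp), ht q⟩

theorem Core.advances_install (hc : Core h m g) {r : R} {desc : Desc B C D}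
    (he : h[e]? = some (.inv t (.rdcss desc))) (hst : g.status e = .pending)
    (hown : g.owner r = e) (hr : m.desc r = some desc)
    (hp : m.data desc.pt2 = some (.val desc.exp2)) :
    Advances h m g rb e (.rdcss desc) l (m.setData desc.pt2 (.rdesc r))
      (.completeReadDesc r (.ret desc.exp2)) := by
  refine ⟨_, rb, hc.install l hr hp hown hst he, ⟨⟨by simp [Mem.setData, hr], by simp [hown]⟩,
    ⟨desc, hr, rfl⟩, .inl ⟨h.length, by simp⟩⟩, ?_, fun x hx hp => ?_⟩
  · have hne {x : ℕ} (hx : g.status x ≠ .pending) : x ≠ e := fun h => hx (h ▸ hst)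
    exact
      { Evolves.refl g rb h.length m.desc with
        installed := fun x r i hx => .inl (by
          simpa [Function.update_of_ne (hne (x := x) (by simp [hx]))] using hx)
        linearized := fun x k out hx => by
          simpa [Function.update_of_ne (hne (x := x) (by simp [hx]))] using hx
        log := fun _ _ _ _ _ h _ => h }
  · simpa [hx] using hp

theorem Core.advances_alloc (hc : Core h m g) {r : R} {desc : Desc B C D}
    (hop : op = .rdcss desc) (hst : g.status e = .pending) (hr : m.desc r = none) :
    Advances h m g rb e op l (m.setDesc r desc) (.loopCAS r desc) := by
  classical
  have hne {r' : R} (hr' : m.desc r' ≠ none) : r' ≠ r := fun h => hr' (h ▸ hr)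
  refine ⟨_, rb, (hc.allocDesc hr desc e).snoc l, ⟨hop, hst, by simp, by simp [Mem.setDesc]⟩,
    ?_, fun _ _ => id⟩
  exact
    { Evolves.refl g rb h.length m.desc with
      desc := fun r' d hd => by
        simpa [Mem.setDesc, hne (r' := r') (by simp [hd])] using hd
      owner := fun r' hr' => by simp [hne hr'] }

/-- Reading the control pointer in `complete` reserves the current position of the log. -/
theorem Core.advances_readPt1 (hc : Core h m g) {r : R} {desc : Desc B C D} {k : PC B C D R}
    {x : Val B C D} (hr : WasInstalled g m.desc r) (hk : ContOK g m.desc r e op k)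
    (hd : m.desc r = some desc) (hx : m.ctrl desc.pt1 = some x) :
    Advances h m g rb e op l m (afterReadPt1 r desc k x) := by
  classical
  have hres (P : Val B C D → Prop) (hP : P x) :
      Reserved g (Function.update rb h.length (some r)) (h.length + 1) r desc.pt1 P := by
    intro i hi
    obtain ⟨-, d, -, hdata⟩ := hc.installed _ _ _ hi
    obtain ⟨i', d', t, -, -, h₁, -, h₂, -⟩ := hc.data_rdesc _ _ hdata
    rw [hi, Status.installed.injEq] at h₁
    exact ⟨h.length, x, by simp, by omega, by omega, hc.log_of_le le_rfl, hc.ctrl _ ▸ hx, hP⟩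
  refine ⟨g, Function.update rb h.length (some r), hc.snoc l, ?_, ?_, fun _ _ => id⟩
  · unfold afterReadPt1
    split_ifs with hxe
    · exact ⟨hr, hk, hd, hres _ hxe⟩
    · exact ⟨hr, hk, hd, hres _ hxe⟩
  · exact
      { Evolves.refl g rb h.length m.desc with
        readBy := fun j r' hj hr' => by simpa [hj.ne] using hr' }

/-- The `CAS` of `complete` linearizes the owner of the descriptor, if it succeeds. -/
theorem Core.advances_complete (hc : Core h m g) {r : R} {desc : Desc B C D} {k : PC B C D R}
    {v : Val B C D} {w : Word B C D R} {P : Val B C D → Prop}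
    (hk : ContOK g m.desc r e op k) (hd : m.desc r = some desc)
    (hres : Reserved g rb h.length r desc.pt1 P)
    (hPv : ∀ u, P u → u = desc.exp1 ∧ v = desc.new2 ∨ u ≠ desc.exp1 ∧ v = desc.exp2)
    (hcas : m.CASData desc.pt2 (.rdesc r) (.val v) w m') :
    Advances h m g rb e op l m' k := by
  obtain ⟨hw, rfl⟩ := hcas
  split_ifs with hwr
  · subst hwr
    obtain ⟨i, desc', t', h₁, -, h₂, -⟩ := hc.data_rdesc _ _ hw
    obtain rfl : desc = desc' := by simpa [hd] using h₁
    obtain ⟨j, u, k₁, k₂, k₃, k₄, k₅, k₆⟩ := hres i h₂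
    have hc' := hc.resolve l hd hw h₂ k₂ k₃ k₄ k₅ (hPv u k₆)
    have ev : Evolves g rb h.length m.desc _ rb m.desc :=
      .insert (j := j) (F := fun H => H.set (.dptr desc.pt2) v) (.rdcss desc)
        (.inr ⟨r, i, desc, h₂, hd, rfl⟩) (fun k c _ _ => Heap.set_of_ne _ _ (by simp))
        (fun r' _ hr' => by rw [Option.some.inj (hr'.symm.trans k₁)])
    have hpend (x : ℕ) (hx : g.status x = .pending) :
        (g.insert j (g.owner r) (.rdcss desc) desc.exp2
          fun H => H.set (.dptr desc.pt2) v).status x = .pending := by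
      have hxr : x ≠ g.owner r := by
        rintro rfl
        rw [hx] at h₂
        cases h₂
      simpa [Ghost.insert, hxr] using hx
    refine ⟨_, rb, hc', (hk.mono ev (hpend e)).pointOK fun i' hi' => ?_, ev, fun x _ => hpend x⟩
    -- The descriptor is gone, so an event returning after `complete r` has been linearized.
    obtain ⟨-, d, h₃, h₄⟩ := hc'.installed _ _ _ hi'
    obtain rfl : desc = d := by simpa [Mem.setData, hd] using h₃
    simp [Mem.setData] at h₄
  · -- If the `CAS` fails, another thread has removed the descriptor before.
    refine hc.advances_silent l (hk.pointOK fun i hi => ?_)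
    obtain ⟨-, d, h₃, h₄⟩ := hc.installed _ _ _ hi
    obtain rfl : desc = d := by simpa [hd] using h₃
    exact hwr (Option.some.inj (hw.symm.trans h₄))

/-- Every primitive preserves the invariants. -/
theorem Exec.advances {pc pc' : PC B C D R} (hx : Exec pc m pc' m') (hc : Core h m g)
    (he : h[e]? = some (.inv t op)) (hok : PointOK g rb h.length m.desc e op pc) :
    Advances h m g rb e op l m' pc' := by
  cases hx with
  | rdcssAlloc hr => exact hc.advances_alloc l hok.1 hok.2 hr
  | @loopCAS _ _ d desc old hcas =>
    obtain ⟨rfl, hst, hown, hd⟩ := hok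
    obtain ⟨hold, rfl⟩ := hcas
    cases old with
    | rdesc r =>
      rw [if_neg (by simp)]
      exact hc.advances_silent l ⟨hc.wasInstalled hold, rfl, hst, hown, hd⟩
    | val v =>
      by_cases hv : v = desc.exp2
      · subst hv
        simp only [afterLoopCAS, if_true]
        exact hc.advances_install l he hst hown hd hold
      · rw [if_neg (by simpa using hv)]
        simp only [afterLoopCAS, if_neg hv]
        refine hc.advances_linearize_read l he hst (.rdcss_ne _ _ _ (hc.data_val _ _ hold) hv) ?_
        rintro p rfl
        exact ⟨v, hold⟩
  | completeReadDesc hd => exact hc.advances_silent l ⟨hok.1, hok.2, hd⟩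
  | completeReadPt1 hx => exact hc.advances_readPt1 l hok.1 hok.2.1 hok.2.2 hx
  | completeCASNew hcas =>
    exact hc.advances_complete l hok.2.1 hok.2.2.1 hok.2.2.2 (fun u hu => .inl ⟨hu, rfl⟩) hcas
  | completeCASExp hcas =>
    exact hc.advances_complete l hok.2.1 hok.2.2.1 hok.2.2.2 (fun u hu => .inr ⟨hu, rfl⟩) hcas
  | @rreadRead _ pt old hold =>
    obtain ⟨rfl, hst⟩ := hok
    cases old with
    | rdesc r => exact hc.advances_silent l ⟨hc.wasInstalled hold, rfl, hst⟩
    | val v =>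
      refine hc.advances_linearize_read l he hst (.rread _ _ _ (hc.data_val _ _ hold)) ?_
      rintro p rfl
      exact ⟨v, hold⟩
  | @rCASCAS _ _ pt exp new old hcas =>
    obtain ⟨rfl, hst⟩ := hok
    obtain ⟨hold, rfl⟩ := hcas
    cases old with
    | rdesc r =>
      rw [if_neg (by simp)]
      exact hc.advances_silent l ⟨hc.wasInstalled hold, rfl, hst⟩
    | val v =>
      by_cases hv : v = exp
      · subst hv
        simp only [afterRCASCAS, if_true]
        exact hc.advances_linearize_data l he hst (.rCAS_eq _ _ _ _ (hc.data_val _ _ hold))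
          (by simp [hold]) fun _ => id
      · rw [if_neg (by simpa using hv)]
        refine hc.advances_linearize_read l he hst (.rCAS_ne _ _ _ _ _ (hc.data_val _ _ hold) hv) ?_
        rintro p rfl
        exact ⟨v, hold⟩
  | @rwriteRead _ pt v old hold =>
    obtain ⟨rfl, hst⟩ := hok
    cases old with
    | rdesc r => exact hc.advances_silent l ⟨hc.wasInstalled hold, rfl, hst⟩
    | val w => exact hc.advances_silent l ⟨rfl, hst⟩
  | @rwriteCAS _ _ pt old v x hcas =>
    obtain ⟨rfl, hst⟩ := hok
    obtain ⟨hold, rfl⟩ := hcas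
    by_cases hxo : x = .val old
    · subst hxo
      simp only [afterRwriteCAS, if_true]
      exact hc.advances_linearize_data l he hst
        (.rwrite _ _ _ (by simp [hc.data_val _ _ hold])) (by simp [hold]) fun _ => id
    · simp only [afterRwriteCAS, if_neg hxo]
      exact hc.advances_silent l ⟨rfl, hst⟩
  | @rreadC _ pt v hv =>
    obtain ⟨rfl, hst⟩ := hok
    exact hc.advances_linearize_read l he hst (.rreadC _ _ _ (hc.ctrl _ ▸ hv)) fun _ => False.elim
  | @rCASC _ _ pt exp new old hcas =>
    obtain ⟨rfl, hst⟩ := hok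
    obtain ⟨hold, rfl⟩ := hcas
    rw [hc.ctrl] at hold
    by_cases hv : old = exp
    · subst hv
      simp only [if_true]
      exact hc.advances_linearize_ctrl l he hst (.rCASC_eq _ _ _ _ hold) fun _ => id
    · simp only [if_neg hv]
      exact hc.advances_linearize_read l he hst (.rCASC_ne _ _ _ _ _ hold hv) fun _ => False.elim
  | @rwriteC _ pt v hv =>
    obtain ⟨rfl, hst⟩ := hok
    exact hc.advances_linearize_ctrl l he hst (.rwriteC _ _ _ (hc.ctrl _ ▸ hv)) fun _ => id
  | @rallocCtrl _ v p hp =>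
    obtain ⟨rfl, hst⟩ := hok
    exact hc.advances_linearize_ctrl l he hst (.ralloc _ _ _ _ rfl (hc.ctrl _ ▸ hp))
      fun q => by simp [Op.Touches]
  | @rallocData _ v p hp =>
    obtain ⟨rfl, hst⟩ := hok
    exact hc.advances_linearize_data l he hst (.ralloc _ _ _ _ rfl (hc.data_none _ hp))
      (by simp [hp]) fun q => by simp [Op.Touches]

end Points

/-! ### The invariant of an execution -/

variable {Tid B C D R : Type*} {h : List (Label Tid (Op B C D) (Val B C D))}
  {g g' : Ghost B C D R}

/-- The event `e` of the thread `t` has terminated, after it was linearized and with the output it was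
linearized with. -/
def Finished (h : List (Label Tid (Op B C D) (Val B C D))) (g : Ghost B C D R) (t : Tid)
    (e : ℕ) : Prop :=
  ∃ j v k, e < j ∧ h[j]? = some (.res t v) ∧ (∀ i w, e < i → i < j → h[i]? ≠ some (.res t w)) ∧
    g.status e = .linearized k v ∧ k < j

/-- The invariant of the executions, for ghost variables that also record the descriptor pointer for
which an action reads a control pointer (`rb`) and the current event of each thread (`cur`). -/
structure Inv (h : List (Label Tid (Op B C D) (Val B C D))) (s : State Tid B C D R)
    (g : Ghost B C D R) (rb : ℕ → Option R) (cur : Tid → ℕ) : Prop where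
  core : Core h s.mem g
  thread : ∀ t pc, s.thread t = .calling pc ∨ s.thread t = .returning pc →
    ∃ op, h[cur t]? = some (.inv t op) ∧ PointOK g rb h.length s.mem.desc (cur t) op pc
  event : ∀ e t op, h[e]? = some (.inv t op) → Finished h g t e ∨
    (cur t = e ∧ s.thread t ≠ .idle ∧ ∀ j w, e < j → h[j]? ≠ some (.res t w))

theorem Finished.snoc {t : Tid} {e : ℕ} (hf : Finished h g t e)
    (l : Label Tid (Op B C D) (Val B C D))
    (hg : ∀ k v, g.status e = .linearized k v → g'.status e = .linearized k v) :
    Finished (h ++ [l]) g' t e := by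
  obtain ⟨j, v, k, h₁, h₂, h₃, h₄, h₅⟩ := hf
  refine ⟨j, v, k, h₁, getElem?_snoc_of_some _ h₂, fun i w hi hij => ?_, hg _ _ h₄, h₅⟩
  have hj := (List.getElem?_eq_some_iff.1 h₂).1
  rw [List.getElem?_append_left (by omega)]
  exact h₃ i w hi hij

theorem Inv.init : Inv (Tid := Tid) [] (State.init Tid B C D R)
    ⟨fun _ => none, fun _ => emptyHeap B C D, fun _ => .pending, fun _ => 0⟩ (fun _ => none)
    (fun _ => 0) where
  core := by constructor <;> simp [State.init, emptyHeap]
  thread := by simp [State.init]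
  event := by simp

theorem PointOK.entry {rb : ℕ → Option R} {n e : ℕ} {md : R → Option (Desc B C D)}
    {op : Op B C D} (he : g.status e = .pending) : PointOK g rb n md e op (op.entry R) := by
  cases op with
  | ralloc v k => cases k <;> exact ⟨rfl, he⟩
  | _ => exact ⟨rfl, he⟩

variable {s s' : State Tid B C D R} {rb : ℕ → Option R} {cur : Tid → ℕ}

theorem Inv.cur_ne (hi : Inv h s g rb cur) {t t' : Tid} {pc pc' : PC B C D R}
    (ht : s.thread t = .calling pc ∨ s.thread t = .returning pc)
    (ht' : s.thread t' = .calling pc' ∨ s.thread t' = .returning pc') (hne : t' ≠ t) :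
    cur t' ≠ cur t := by
  intro hcur
  obtain ⟨op, h₁, -⟩ := hi.thread _ _ ht
  obtain ⟨op', h₂, -⟩ := hi.thread _ _ ht'
  rw [hcur, h₁] at h₂
  simp only [Option.some.injEq, Label.inv.injEq] at h₂
  exact hne h₂.1.symm

theorem Inv.invoke (hi : Inv h s g rb cur) {t : Tid} (op : Op B C D)
    (ht : s.thread t = .idle) :
    ∃ cur', Inv (h ++ [.inv t op]) (s.setThread t (.calling (op.entry R))) g rb cur' := by
  classical
  refine ⟨Function.update cur t h.length, hi.core.snoc _, fun t' pc ht' => ?_,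
    fun e t' op' he => ?_⟩
  · by_cases htt : t' = t
    · subst htt
      simp only [State.setThread, Function.update_self, Thread.calling.injEq, reduceCtorEq,
        or_false] at ht'
      subst ht'
      rw [Function.update_self]
      exact ⟨op, by simp, .entry (hi.core.status_of_le _ le_rfl)⟩
    · simp only [State.setThread, Function.update_of_ne htt] at ht'
      obtain ⟨op', h₁, h₂⟩ := hi.thread _ _ ht'
      rw [Function.update_of_ne htt, List.length_append, List.length_singleton]
      exact ⟨op', getElem?_snoc_of_some _ h₁, h₂.mono (.refl _ _ _ _) id⟩
  · rcases getElem?_snoc_eq_some he with he | ⟨rfl, heq⟩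
    · refine (hi.event _ _ _ he).imp (fun hf => hf.snoc _ fun _ _ => id) fun ⟨h₁, h₂, h₃⟩ => ?_
      have htt : t' ≠ t := by
        rintro rfl
        exact h₂ ht
      refine ⟨by simpa [Function.update_of_ne htt] using h₁,
        by simpa [State.setThread, Function.update_of_ne htt] using h₂, fun j w hj hres => ?_⟩
      rcases getElem?_snoc_eq_some hres with hres | ⟨-, heq⟩
      · exact h₃ j w hj hres
      · cases heq
    · cases heq
      refine .inr ⟨by simp, by simp [State.setThread], fun j w hj hres => ?_⟩
      have := (List.getElem?_eq_some_iff.1 hres).1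
      rw [List.length_append, List.length_singleton] at this
      omega

theorem Inv.respond (hi : Inv h s g rb cur) {t : Tid} {out : Val B C D}
    (ht : s.thread t = .calling (.ret out)) :
    Inv (h ++ [.res t out]) (s.setThread t .idle) g rb cur := by
  classical
  refine ⟨hi.core.snoc _, fun t' pc ht' => ?_, fun e t' op he => ?_⟩
  · by_cases htt : t' = t
    · subst htt
      simp [State.setThread] at ht'
    · simp only [State.setThread, Function.update_of_ne htt] at ht'
      obtain ⟨op', h₁, h₂⟩ := hi.thread _ _ ht'
      rw [List.length_append, List.length_singleton]
      exact ⟨op', getElem?_snoc_of_some _ h₁, h₂.mono (.refl _ _ _ _) id⟩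
  · rcases getElem?_snoc_eq_some he with he | ⟨-, heq⟩
    · rcases hi.event _ _ _ he with hf | ⟨h₁, h₂, h₃⟩
      · exact .inl (hf.snoc _ fun _ _ => id)
      by_cases htt : t' = t
      · subst htt
        subst h₁
        obtain ⟨_, -, k, hk⟩ := hi.thread _ _ (.inl ht)
        obtain ⟨_, hlog⟩ := hi.core.status_log _ _ _ hk
        have hlt := hi.core.log_lt _ _ _ _ hlog
        refine .inl ⟨h.length, out, k, by omega, by simp, fun i w hi hil => ?_, hk, hlt.2⟩
        rw [List.getElem?_append_left hil]
        exact h₃ i w hi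
      · refine .inr ⟨h₁, by simpa [State.setThread, Function.update_of_ne htt] using h₂,
          fun j w hj hres => ?_⟩
        rcases getElem?_snoc_eq_some hres with hres | ⟨-, heq⟩
        · exact h₃ j w hj hres
        · cases heq
          exact htt rfl
    · cases heq

/-- Internal steps preserve the invariant. -/
theorem Inv.internal (hi : Inv h s g rb cur) {t : Tid} {pc pc' : PC B C D R} {op : Op B C D}
    {T : Thread B C D R} {m' : Mem B C D R}
    (ht : s.thread t = .calling pc ∨ s.thread t = .returning pc)
    (hT : T = .calling pc' ∨ T = .returning pc') (hop : h[cur t]? = some (.inv t op))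
    (ha : Advances h s.mem g rb (cur t) op .tau m' pc') :
    ∃ g' rb', Inv (h ++ [.tau]) { s.setThread t T with mem := m' } g' rb' cur := by
  classical
  obtain ⟨g', rb', hc, hpc, ev, hpend⟩ := ha
  refine ⟨g', rb', hc, fun t' pc'' ht' => ?_, fun e t' op' he => ?_⟩
  · rw [List.length_append, List.length_singleton]
    by_cases htt : t' = t
    · subst htt
      obtain rfl : pc' = pc'' := by
        rcases hT with rfl | rfl <;> simpa [State.setThread] using ht'
      exact ⟨op, getElem?_snoc_of_some _ hop, hpc⟩
    · simp only [State.setThread, Function.update_of_ne htt] at ht'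
      obtain ⟨op', h₁, h₂⟩ := hi.thread _ _ ht'
      exact ⟨op', getElem?_snoc_of_some _ h₁, h₂.mono ev (hpend _ (hi.cur_ne ht ht' htt))⟩
  · rcases getElem?_snoc_eq_some he with he | ⟨-, heq⟩
    · refine (hi.event _ _ _ he).imp (fun hf => hf.snoc _ (ev.linearized e)) fun ⟨h₁, h₂, h₃⟩ => ?_
      refine ⟨h₁, ?_, fun j w hj hres => ?_⟩
      · by_cases htt : t' = t
        · subst htt
          rcases hT with rfl | rfl <;> simp [State.setThread]
        · simpa [State.setThread, Function.update_of_ne htt] using h₂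
      · rcases getElem?_snoc_eq_some hres with hres | ⟨-, heq⟩
        · exact h₃ j w hj hres
        · cases heq
    · cases heq

theorem Run.exists_inv (hrun : Run h s) :
    ∃ (g : Ghost B C D R) (rb : ℕ → Option R) (cur : Tid → ℕ), Inv h s g rb cur := by
  induction hrun with
  | nil => exact ⟨_, _, _, .init⟩
  | snoc _ hstep ih =>
    obtain ⟨g, rb, cur, hi⟩ := ih
    cases hstep with
    | invoke ht _ => exact ⟨g, rb, hi.invoke _ ht⟩
    | effect ht hx =>
      obtain ⟨op, h₁, h₂⟩ := hi.thread _ _ (.inl ht)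
      obtain ⟨g', rb', hi'⟩ :=
        hi.internal (.inl ht) (.inr rfl) h₁ (hx.advances .tau hi.core h₁ h₂)
      exact ⟨g', rb', cur, hi'⟩
    | primReturn ht =>
      obtain ⟨op, h₁, h₂⟩ := hi.thread _ _ (.inr ht)
      obtain ⟨g', rb', hi'⟩ := hi.internal (.inr ht) (.inl rfl) h₁
        (hi.core.advances_silent .tau (h₂.mono (.refl _ _ _ _) id))
      exact ⟨g', rb', cur, hi'⟩
    | respond ht => exact ⟨g, rb, cur, hi.respond ht⟩

end RDCSS

theorem mainTheorem2 {Tid B C D R : Type*}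
    (h : List (Concurrency.Label Tid (RDCSS.Op B C D) (RDCSS.Val B C D)))
    (s : RDCSS.State Tid B C D R) (hrun : RDCSS.Run h s) :
    Concurrency.Linearizable RDCSS.OpStep (RDCSS.emptyHeap B C D) h := by
  obtain ⟨g, rb, cur, hi⟩ := hrun.exists_inv
  have hc := hi.core
  refine .of_log g.log g.heap hc.heap_zero hc.heap_none hc.heap_some hc.log_inv
    (fun k k' e op op' out out' hk hk' => ?_) hc.log_lt fun x j v hj => ?_
  · have := (hc.log_status _ _ _ _ hk).symm.trans (hc.log_status _ _ _ _ hk')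
    simp only [RDCSS.Status.linearized.injEq] at this
    exact this.1
  · rcases hi.event _ _ _ x.isInv with ⟨j', v', k, h₁, h₂, h₃, h₄, h₅⟩ | ⟨-, -, hres⟩
    · obtain ⟨rfl, rfl⟩ := hj.unique (j' := j') (v' := v') ⟨h₁, h₂, h₃⟩
      obtain ⟨op, hk⟩ := hc.status_log _ _ _ h₄
      exact ⟨k, op, hk, h₅⟩
    · exact absurd hj.2.1 (hres j v hj.1)
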